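/- Let $q\in\mathbb{C}$ with $0<|q|<1$, and let $K=\mathbb{C}(\{z\})$ be the field of convergent Laurent series over $\mathbb{C}$ (finitely many negative powers of $z$, convergent on some punctured disc around $0$), with the automorphism $\phi$ given by $\phi(f)(z)=f(qz)$ and the valuation $v$ given by the order at $z=0$. A $q$-difference module over $K$ is a finite dimensional $K$-vector space $M$ with an additive bijection $\Phi:M\to M$ such that $\Phi(fm)=\phi(f)\Phi(m)$ for $f\in K$, $m\in M$. A submodule of it is a $K$-subspace that is stable under $\Phi$ and $\Phi^{-1}$; submodules and quotients by them are again $q$-difference modules. Let $L=\Phi^m+a_{m-1}\Phi^{m-1}+\cdots+a_0$ with $a_i\in K$, $a_0\neq0$, and put $a_m=1$. The Newton polygon of $L$ is the lower boundary of the convex hull of the points $(i,v(a_i))$, $0\le i\le m$, $a_i\ne 0$. A rational number $\lambda$ is called a slope of $L$ if $-\lambda$ is the slope of an edge of this polygon (so $\Phi-cz^t$ with $c\in\mathbb{C}^*$ and $t\in\mathbb{Z}$ has the slope $t$). A $q$-difference module $M$ is pure of slope $\lambda$ if $M\cong K[\Phi,\Phi^{-1}]/K[\Phi,\Phi^{-1}]L$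 for such an $L$ with $\lambda$ as its only slope; that is, there is an $e\in M$ such that $e,\Phi e,\dots,\Phi^{m-1}e$ is a $K$-basis of $M$ and $\Phi^m e+a_{m-1}\Phi^{m-1}e+\cdots+a_0e=0$. (The zero module is not pure.) Theorem. Every $q$-difference module $M$ over $K$ has a unique tower of submodules $0=M_0\subset M_1\subset\cdots\subset M_r=M$ (strict inclusions, $r\ge 0$) such that every quotient $M_i/M_{i-1}$ is pure of some slope $\lambda_i\in\mathbb{Q}$ and $\lambda_1<\cdots<\lambda_r$. That is, such a tower exists, and the number $r$, the submodules $M_i$ and the slopes $\lambda_i$ are uniquely determined by $M$. -/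

import Mathlib

namespace QDiff

open HahnSeries

/-- A formal complex Laurent series (finitely many negative exponents) is convergent if it
converges absolutely at some radius `r > 0`, hence on the punctured disc `0 < |z| ≤ r`. -/
def IsConvergent (f : LaurentSeries ℂ) : Prop :=
  ∃ r : ℝ, 0 < r ∧ Summable fun n : ℤ => ‖f.coeff n‖ * r ^ n

theorem summable_of_le {f : LaurentSeries ℂ} {r s : ℝ} (hs : 0 < s) (hsr : s ≤ r)
    (h : Summable fun n : ℤ => ‖f.coeff n‖ * r ^ n) :
    Summable fun n : ℤ => ‖f.coeff n‖ * s ^ n := by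
  have hr : 0 < r := hs.trans_le hsr
  refine Summable.of_nonneg_of_le (fun n => by positivity) (fun n => ?_)
    (h.mul_left ((s / r) ^ f.order))
  by_cases hn : f.coeff n = 0
  · simp [hn]
  · have h1 : f.order ≤ n := order_le_of_coeff_ne_zero hn
    have h2 : (s / r) ^ n ≤ (s / r) ^ f.order :=
      zpow_le_zpow_right_of_le_one₀ (by positivity) ((div_le_one hr).2 hsr) h1
    have h3 : s ^ n = (s / r) ^ n * r ^ n := by
      rw [div_zpow]; field_simp
    rw [h3]
    calc ‖f.coeff n‖ * ((s / r) ^ n * r ^ n) = (s / r) ^ n * (‖f.coeff n‖ * r ^ n) := by ring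
      _ ≤ _ := mul_le_mul_of_nonneg_right h2 (by positivity)

theorem IsConvergent.common {f g : LaurentSeries ℂ} (hf : IsConvergent f) (hg : IsConvergent g) :
    ∃ r : ℝ, 0 < r ∧ (Summable fun n : ℤ => ‖f.coeff n‖ * r ^ n) ∧
      Summable fun n : ℤ => ‖g.coeff n‖ * r ^ n := by
  obtain ⟨r, hr, hf⟩ := hf
  obtain ⟨s, hs, hg⟩ := hg
  exact ⟨min r s, lt_min hr hs, summable_of_le (lt_min hr hs) (min_le_left _ _) hf,
    summable_of_le (lt_min hr hs) (min_le_right _ _) hg⟩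

theorem IsConvergent.add {f g : LaurentSeries ℂ} (hf : IsConvergent f) (hg : IsConvergent g) :
    IsConvergent (f + g) := by
  obtain ⟨r, hr, hf, hg⟩ := hf.common hg
  refine ⟨r, hr, Summable.of_nonneg_of_le (fun n => by positivity) (fun n => ?_) (hf.add hg)⟩
  rw [coeff_add, ← add_mul]
  exact mul_le_mul_of_nonneg_right (norm_add_le _ _) (by positivity)

theorem IsConvergent.neg {f : LaurentSeries ℂ} (hf : IsConvergent f) : IsConvergent (-f) := by
  obtain ⟨r, hr, hf⟩ := hf
  exact ⟨r, hr, by simpa using hf⟩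

theorem isConvergent_single (k : ℤ) (c : ℂ) : IsConvergent (single k c) := by
  refine ⟨1, one_pos, summable_of_ne_finset_zero (s := {k}) fun n hn => ?_⟩
  rw [coeff_single_of_ne (by simpa using hn)]
  simp

theorem IsConvergent.mul {f g : LaurentSeries ℂ} (hf : IsConvergent f) (hg : IsConvergent g) :
    IsConvergent (f * g) := by
  obtain ⟨r, hr, hf, hg⟩ := hf.common hg
  have hfg := hf.mul_of_nonneg hg (fun n => by positivity) (fun n => by positivity)
  refine ⟨r, hr, summable_of_sum_le (c := ∑' x : ℤ × ℤ, (‖f.coeff x.1‖ * r ^ x.1) *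
    (‖g.coeff x.2‖ * r ^ x.2)) (fun n => by positivity) fun u => ?_⟩
  calc ∑ n ∈ u, ‖(f * g).coeff n‖ * r ^ n
      ≤ ∑ n ∈ u, ∑ x ∈ Finset.antidiagonal f.isPWO_support g.isPWO_support n,
          (‖f.coeff x.1‖ * r ^ x.1) * (‖g.coeff x.2‖ * r ^ x.2) := by
        refine Finset.sum_le_sum fun n _ => ?_
        rw [coeff_mul]
        refine (mul_le_mul_of_nonneg_right (norm_sum_le _ _) (by positivity)).trans ?_
        rw [Finset.sum_mul]
        refine Finset.sum_le_sum fun x hx => ?_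
        have hx' : x.1 + x.2 = n := (Finset.mem_antidiagonal.1 hx).2.2
        rw [← hx', zpow_add₀ hr.ne', norm_mul]
        exact le_of_eq (by ring)
    _ = ∑ x ∈ u.biUnion fun n => Finset.antidiagonal f.isPWO_support g.isPWO_support n,
          (‖f.coeff x.1‖ * r ^ x.1) * (‖g.coeff x.2‖ * r ^ x.2) := by
        rw [Finset.sum_biUnion]
        intro a _ b _ hab
        refine Finset.disjoint_left.2 fun x hxa hxb => hab ?_
        exact (Finset.mem_antidiagonal.1 hxa).2.2.symm.trans (Finset.mem_antidiagonal.1 hxb).2.2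
    _ ≤ _ := hfg.sum_le_tsum _ fun x _ => by positivity

theorem isConvergent_ofPowerSeries {p : PowerSeries ℂ} {r : ℝ} (hr : 0 < r)
    (h : Summable fun n : ℕ => ‖PowerSeries.coeff n p‖ * r ^ n) :
    IsConvergent (ofPowerSeries ℤ ℂ p) := by
  refine ⟨r, hr, ?_⟩
  have hinj : Function.Injective ((↑) : ℕ → ℤ) := Nat.cast_injective
  refine (hinj.summable_iff fun n hn => ?_).1 ?_
  · rw [ofPowerSeries_apply, embDomain_of_notMem_range (by simpa using hn)]
    simp
  · refine h.congr fun n => ?_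
    simp [ofPowerSeries_apply_coeff]

theorem isConvergent_ofPowerSeries_inv {p : PowerSeries ℂ} {r : ℝ} (hr : 0 < r)
    (hp : PowerSeries.constantCoeff p ≠ 0)
    (h : Summable fun n : ℕ => ‖PowerSeries.coeff n p‖ * r ^ n) :
    IsConvergent (ofPowerSeries ℤ ℂ p⁻¹) := by
  set c : ℝ := ‖PowerSeries.constantCoeff p‖ with hc
  have hc0 : 0 < c := norm_pos_iff.2 hp
  set S : ℝ := ∑' n : ℕ, ‖PowerSeries.coeff n p‖ * r ^ n with hS
  have hS0 : 0 ≤ S := tsum_nonneg fun n => by positivity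
  obtain ⟨e, he0, he1, heS⟩ : ∃ e : ℝ, 0 < e ∧ e ≤ 1 ∧ e * S ≤ c := by
    refine ⟨min 1 (c / (S + 1)), lt_min one_pos (by positivity), min_le_left _ _, ?_⟩
    calc min 1 (c / (S + 1)) * S ≤ c / (S + 1) * S :=
          mul_le_mul_of_nonneg_right (min_le_right _ _) hS0
      _ ≤ c := by
          rw [div_mul_eq_mul_div, div_le_iff₀ (by positivity)]
          nlinarith
  have hs : 0 < e * r := by positivity
  have key : ∀ n : ℕ, ‖PowerSeries.coeff n p⁻¹‖ * (e * r) ^ n ≤ c⁻¹ := by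
    intro n
    induction n using Nat.strong_induction_on with
    | _ n ih =>
      rw [PowerSeries.coeff_inv]
      split_ifs with hn
      · subst hn
        simp [hc]
      · rw [norm_mul, norm_neg, norm_inv, ← hc, mul_assoc]
        refine mul_le_of_le_one_right (by positivity) ?_
        refine (mul_le_mul_of_nonneg_right (norm_sum_le _ _) (by positivity)).trans ?_
        rw [Finset.sum_mul]
        calc _ ≤ ∑ x ∈ Finset.HasAntidiagonal.antidiagonal n,
                  c⁻¹ * (e * (‖PowerSeries.coeff x.1 p‖ * r ^ x.1)) := by
                refine Finset.sum_le_sum fun x hx => ?_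
                have hx' : x.1 + x.2 = n := Finset.HasAntidiagonal.mem_antidiagonal.1 hx
                split_ifs with hlt
                · have h1 : x.1 ≠ 0 := by omega
                  have h2 : e ^ x.1 ≤ e := pow_le_of_le_one he0.le he1 h1
                  have h3 := ih x.2 hlt
                  rw [norm_mul, ← hx', _root_.pow_add, mul_pow e r x.1]
                  calc _ = (‖PowerSeries.coeff x.2 p⁻¹‖ * (e * r) ^ x.2) *
                            (e ^ x.1 * (‖PowerSeries.coeff x.1 p‖ * r ^ x.1)) := by ring
                    _ ≤ _ := by gcongr
                · simp only [norm_zero, zero_mul]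
                  positivity
          _ = c⁻¹ * (e * ∑ k ∈ Finset.range (n + 1), ‖PowerSeries.coeff k p‖ * r ^ k) := by
                rw [← Finset.mul_sum, ← Finset.mul_sum,
                  Finset.Nat.sum_antidiagonal_eq_sum_range_succ_mk]
          _ ≤ c⁻¹ * (e * S) := by
                gcongr
                exact h.sum_le_tsum _ fun k _ => by positivity
          _ ≤ 1 := by
                rw [inv_mul_le_iff₀ hc0]
                simpa using heS
  refine isConvergent_ofPowerSeries (r := e * r / 2) (by positivity) ?_
  refine Summable.of_nonneg_of_le (fun n => by positivity) (fun n => ?_)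
    ((summable_geometric_two).mul_left c⁻¹)
  rw [div_eq_mul_one_div (e * r) 2, mul_pow, ← mul_assoc]
  exact mul_le_mul_of_nonneg_right (key n) (by positivity)

theorem IsConvergent.inv {f : LaurentSeries ℂ} (hf : IsConvergent f) : IsConvergent f⁻¹ := by
  by_cases h0 : f = 0
  · simpa [h0] using hf
  have hp : PowerSeries.constantCoeff f.powerSeriesPart ≠ 0 := by
    rw [← PowerSeries.coeff_zero_eq_constantCoeff_apply, LaurentSeries.powerSeriesPart_coeff]
    simpa using coeff_order_eq_zero.not.2 h0
  obtain ⟨r, hr, hs⟩ := hf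
  have hs' : Summable fun n : ℕ => ‖PowerSeries.coeff n f.powerSeriesPart‖ * r ^ n := by
    have h1 := (hs.comp_injective (i := fun n : ℕ => f.order + (n : ℤ))
      fun a b hab => by simpa using hab).mul_left (r ^ (-f.order))
    refine h1.congr fun n => ?_
    simp only [Function.comp, LaurentSeries.powerSeriesPart_coeff, zpow_add₀ hr.ne', zpow_neg,
      zpow_natCast]
    field_simp
  have hinv : f⁻¹ = single (-f.order) 1 * ofPowerSeries ℤ ℂ f.powerSeriesPart⁻¹ := by
    refine inv_eq_of_mul_eq_one_right ?_
    have h2 := LaurentSeries.single_order_mul_powerSeriesPart f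
    calc f * _ = _ := congrArg (· * _) h2.symm
      _ = 1 := ?_
    rw [mul_mul_mul_comm, single_mul_single, ← map_mul,
      PowerSeries.mul_inv_cancel _ hp]
    simp
  rw [hinv]
  exact (isConvergent_single _ _).mul (isConvergent_ofPowerSeries_inv hr hp hs')

/-- The field `K = ℂ({z})` of convergent Laurent series. -/
def ConvLaurent : Subfield (LaurentSeries ℂ) where
  carrier := {f | IsConvergent f}
  mul_mem' := IsConvergent.mul
  one_mem' := isConvergent_single 0 1
  add_mem' := IsConvergent.add
  zero_mem' := by simpa using isConvergent_single 0 0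
  neg_mem' := IsConvergent.neg
  inv_mem' _ := IsConvergent.inv

/-- `f(z) ↦ f(qz)` on formal Laurent series: the coefficient of `z ^ n` is multiplied
by `q ^ n`. -/
noncomputable def dilate (q : ℂˣ) (f : LaurentSeries ℂ) : LaurentSeries ℂ where
  coeff n := (q : ℂ) ^ n * f.coeff n
  isPWO_support' := f.isPWO_support.mono fun n hn h => hn (by simp [h])

theorem dilate_coeff (q : ℂˣ) (f : LaurentSeries ℂ) (n : ℤ) :
    (dilate q f).coeff n = (q : ℂ) ^ n * f.coeff n := rfl

theorem dilate_support (q : ℂˣ) (f : LaurentSeries ℂ) : (dilate q f).support = f.support := by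
  ext n
  simp [dilate_coeff, zpow_ne_zero]

theorem dilate_mul (q : ℂˣ) (f g : LaurentSeries ℂ) :
    dilate q (f * g) = dilate q f * dilate q g := by
  ext n
  rw [dilate_coeff, coeff_mul, coeff_mul_left' f.isPWO_support (dilate_support q f).subset,
    Finset.mul_sum]
  refine Finset.sum_congr ?_ fun x hx => ?_
  · ext x
    simp [dilate_coeff, zpow_ne_zero]
  · rw [← (Finset.mem_antidiagonal.1 hx).2.2, zpow_add₀ q.ne_zero, dilate_coeff, dilate_coeff]
    ring

theorem dilate_add (q : ℂˣ) (f g : LaurentSeries ℂ) :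
    dilate q (f + g) = dilate q f + dilate q g := by
  ext n
  simp [dilate_coeff, mul_add]

theorem dilate_dilate (p q : ℂˣ) (f : LaurentSeries ℂ) :
    dilate p (dilate q f) = dilate (p * q) f := by
  ext n
  simp [dilate_coeff, mul_zpow, mul_assoc]

theorem dilate_one (f : LaurentSeries ℂ) : dilate 1 f = f := by
  ext n
  simp [dilate_coeff]

theorem IsConvergent.dilate {f : LaurentSeries ℂ} (hf : IsConvergent f) (q : ℂˣ) :
    IsConvergent (dilate q f) := by
  obtain ⟨r, hr, h⟩ := hf
  have hq : 0 < ‖(q : ℂ)‖ := norm_pos_iff.2 q.ne_zero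
  refine ⟨r / ‖(q : ℂ)‖, by positivity, h.congr fun n => ?_⟩
  rw [dilate_coeff, norm_mul, norm_zpow, div_zpow]
  field_simp

/-- The automorphism `φ` of `K` with `φ(f)(z) = f(qz)`. -/
noncomputable def qShift (q : ℂˣ) : ConvLaurent ≃+* ConvLaurent where
  toFun f := ⟨dilate q f, IsConvergent.dilate f.2 q⟩
  invFun f := ⟨dilate q⁻¹ f, IsConvergent.dilate f.2 q⁻¹⟩
  left_inv f := Subtype.ext (by simp [dilate_dilate, dilate_one])
  right_inv f := Subtype.ext (by simp [dilate_dilate, dilate_one])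
  map_mul' f g := Subtype.ext (dilate_mul q f g)
  map_add' f g := Subtype.ext (dilate_add q f g)

/-- The order at `z = 0` of a convergent Laurent series; it is the valuation `v` on nonzero
elements, and is only ever applied to those. -/
noncomputable def ord (f : ConvLaurent) : ℤ := (f : LaurentSeries ℂ).order

/-- The slopes of the Newton polygon of `L = a₀ + a₁ Φ + ⋯ + a_m Φ ^ m`. The polygon is the lower
boundary of the convex hull of the points `(i, v(a_i))` with `a_i ≠ 0`. An edge of it is carried by
a line through two of these points such that no point lies below the line. The sign is
normalized such that `Φ - c z ^ t` has slope `t`: the line `y = h - lam * x` gives the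
slope `lam`. -/
def newtonSlopes {m : ℕ} (a : Fin (m + 1) → ConvLaurent) : Set ℚ :=
  {lam | ∃ h : ℚ,
    (∃ i j : Fin (m + 1), i ≠ j ∧ a i ≠ 0 ∧ a j ≠ 0 ∧
      (ord (a i) : ℚ) = h - lam * ((i : ℕ) : ℚ) ∧ (ord (a j) : ℚ) = h - lam * ((j : ℕ) : ℚ)) ∧
    ∀ k : Fin (m + 1), a k ≠ 0 → h - lam * ((k : ℕ) : ℚ) ≤ (ord (a k) : ℚ)}

section Modules

variable {q : ℂˣ} {M : Type*} [AddCommGroup M] [Module ConvLaurent M]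

/-- `(M, Φ)` is isomorphic to `K[Φ, Φ⁻¹] / K[Φ, Φ⁻¹] L` for the monic operator
`L = Φ ^ m + a_{m-1} Φ ^ (m-1) + ⋯ + a₀` with `a₀ ≠ 0`: there is a vector `e` (the image of `1`)
such that `e, Φ e, …, Φ ^ (m-1) e` is a basis of `M` over `K`, and `L e = 0`. -/
def IsPresentedBy (Φ : M →ₛₗ[(qShift q : ConvLaurent →+* ConvLaurent)] M) {m : ℕ}
    (a : Fin (m + 1) → ConvLaurent) : Prop :=
  a (Fin.last m) = 1 ∧ a 0 ≠ 0 ∧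
    ∃ e : M, LinearIndependent ConvLaurent (fun i : Fin m => Φ^[i] e) ∧
      Submodule.span ConvLaurent (Set.range fun i : Fin m => Φ^[i] e) = ⊤ ∧
      ∑ i : Fin (m + 1), a i • Φ^[i] e = 0

/-- `(M, Φ)` is pure of slope `lam`: the Newton polygon of an operator presenting `M` has `lam` as
its only slope. The zero module has no slope and is not pure. -/
def IsPure (Φ : M →ₛₗ[(qShift q : ConvLaurent →+* ConvLaurent)] M) (lam : ℚ) : Prop :=
  ∃ (m : ℕ) (a : Fin (m + 1) → ConvLaurent), IsPresentedBy Φ a ∧ newtonSlopes a = {lam}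

/-- Difference submodules: subspaces stable under `Φ` and under `Φ⁻¹`. -/
def IsStable (Φ : M →ₛₗ[(qShift q : ConvLaurent →+* ConvLaurent)] M)
    (N : Submodule ConvLaurent M) : Prop :=
  ∀ x, Φ x ∈ N ↔ x ∈ N

/-- The map that `Φ` induces on the quotient `N₂ / N₁` of difference submodules `N₁ ⊆ N₂`. -/
noncomputable def subquotient (Φ : M →ₛₗ[(qShift q : ConvLaurent →+* ConvLaurent)] M)
    (N₁ N₂ : Submodule ConvLaurent M) (h₁ : IsStable Φ N₁) (h₂ : IsStable Φ N₂) :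
    (N₂ ⧸ N₁.submoduleOf N₂) →ₛₗ[(qShift q : ConvLaurent →+* ConvLaurent)]
      (N₂ ⧸ N₁.submoduleOf N₂) :=
  Submodule.mapQ (N₁.submoduleOf N₂) (N₁.submoduleOf N₂)
    (Φ.restrict fun x hx => (h₂ x).2 hx) fun x hx => (h₁ x).2 hx

/-- `0 = N 0 ⊂ N 1 ⊂ ⋯ ⊂ N r = M` is a tower of difference submodules whose successive quotients
are pure of slopes `lam 0 < ⋯ < lam (r - 1)`. -/
structure IsSlopeFiltration (Φ : M →ₛₗ[(qShift q : ConvLaurent →+* ConvLaurent)] M) {r : ℕ}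
    (N : Fin (r + 1) → Submodule ConvLaurent M) (lam : Fin r → ℚ) : Prop where
  stable : ∀ i, IsStable Φ (N i)
  bot : N 0 = ⊥
  top : N (Fin.last r) = ⊤
  strictMono : StrictMono N
  pure : ∀ i : Fin r, IsPure
    (subquotient Φ (N i.castSucc) (N i.succ) (stable i.castSucc) (stable i.succ)) (lam i)
  slopes_strictMono : StrictMono lam

end Modules

end QDiff

/- Newton polygons split operators: an operator whose first edge on the left has slope `lam` factors
as `A B` with `B` pure of slope `lam` and the slopes of `A` below `lam`. Scaled by the first edge,
the factorization is a quadratic equation for the coefficients. It is a contraction for the order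
filtration, and the iterates stay bounded in a weighted `ℓ¹` norm of small radius because, for
`|q| ≤ 1`, the dilations `f(z) ↦ f(q ^ i z)` with `i ≥ 0` increase this norm by at most a constant
factor on series of bounded pole order; hence the formal solution converges.

A difference module has a cyclic vector `e`, with an annihilating operator of least degree. If this
operator is `A B`, then `B e` generates a submodule with operator `A` whose quotient has the
operator `B`; by induction this gives a tower with increasing slopes.

The tower is unique since there are no nonzero morphisms between pure modules of different slopes:
two pure operators of slopes `lam ≠ lam'` cannot annihilate the same nonzero vector. -/

namespace QDiff

open scoped ENNReal Polynomial Topology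

section OrderFiltration

open HahnSeries

variable {R : Type*} [Ring R] {c d : ℚ}

/-- The order filtration on Laurent series: the series all of whose coefficients in degrees
below `c` vanish. The bound is rational because the lines bounding a Newton polygon pass through
rational heights. -/
def orderGE (c : ℚ) : AddSubgroup (LaurentSeries R) where
  carrier := {f | ∀ n : ℤ, (n : ℚ) < c → f.coeff n = 0}
  zero_mem' _ _ := rfl
  add_mem' hf hg n hn := by rw [coeff_add, hf n hn, hg n hn, add_zero]
  neg_mem' hf n hn := by rw [coeff_neg, hf n hn, neg_zero]

theorem orderGE_antitone : Antitone (orderGE : ℚ → AddSubgroup (LaurentSeries R)) :=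
  fun _ _ h _ hf n hn => hf n (hn.trans_le h)

theorem mul_mem_orderGE {f g : LaurentSeries R} (hf : f ∈ orderGE c) (hg : g ∈ orderGE d) :
    f * g ∈ orderGE (c + d) := by
  intro n hn
  rw [coeff_mul]
  refine Finset.sum_eq_zero fun x hx => ?_
  have hx' : x.1 + x.2 = n := (Finset.mem_antidiagonal.1 hx).2.2
  by_cases h : (x.1 : ℚ) < c
  · rw [hf _ h, zero_mul]
  · rw [hg _ (by rw [← hx'] at hn; push_cast at hn; linarith), mul_zero]

theorem mem_orderGE_iff_order {f : LaurentSeries R} (hf : f ≠ 0) :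
    f ∈ orderGE c ↔ c ≤ f.order := by
  refine ⟨fun h => ?_, fun h n hn => ?_⟩
  · by_contra! hlt
    exact coeff_order_eq_zero.not.2 hf (h _ hlt)
  · exact coeff_eq_zero_of_lt_order (by exact_mod_cast hn.trans_le h)

theorem eq_zero_of_forall_mem_orderGE {f : LaurentSeries R} {δ : ℚ} (hδ : 0 < δ)
    (h : ∀ s : ℕ, f ∈ orderGE (c + s * δ)) : f = 0 := by
  ext n
  obtain ⟨s, hs⟩ := exists_nat_gt ((n - c) / δ)
  rw [div_lt_iff₀ hδ] at hs
  exact h s n (by linarith)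

theorem coeff_eq_of_sub_mem_orderGE {f g : LaurentSeries R} (h : f - g ∈ orderGE c) {n : ℤ}
    (hn : (n : ℚ) < c) : f.coeff n = g.coeff n := by
  rw [← sub_eq_zero, ← coeff_sub]
  exact h n hn

theorem sub_mem_orderGE_of_step {f : ℕ → LaurentSeries R} {δ : ℚ} (hδ : 0 < δ)
    (h : ∀ s : ℕ, f (s + 1) - f s ∈ orderGE (c + s * δ)) {s t : ℕ} (hst : s ≤ t) :
    f t - f s ∈ orderGE (c + s * δ) := by
  induction t, hst using Nat.le_induction with
  | base => rw [sub_self]; exact zero_mem _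
  | succ t hst ih =>
    have hgain : c + s * δ ≤ c + t * δ := by gcongr
    rw [← sub_add_sub_cancel]
    exact add_mem (orderGE_antitone hgain (h t)) ih

theorem exists_limit_of_sub_mem_orderGE {f : ℕ → LaurentSeries R} {δ : ℚ} (hδ : 0 < δ)
    (h : ∀ s : ℕ, f (s + 1) - f s ∈ orderGE (c + s * δ)) :
    ∃ g : LaurentSeries R, ∀ s : ℕ, g - f s ∈ orderGE (c + s * δ) := by
  choose S hS using fun n : ℤ => exists_nat_gt (((n : ℚ) - c) / δ)
  have hstable : ∀ (n : ℤ) (s : ℕ), (n : ℚ) < c + s * δ → (f (S n)).coeff n = (f s).coeff n := by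
    intro n s hs
    have hSn : (n : ℚ) < c + S n * δ := by linarith [(div_lt_iff₀ hδ).1 (hS n)]
    rcases le_total s (S n) with hle | hle
    · exact coeff_eq_of_sub_mem_orderGE (sub_mem_orderGE_of_step hδ h hle) hs
    · exact (coeff_eq_of_sub_mem_orderGE (sub_mem_orderGE_of_step hδ h hle) hSn).symm
  refine ⟨ofSuppBddBelow (fun n => (f (S n)).coeff n) ⟨min ⌊c⌋ (f 0).order, fun n hn => ?_⟩,
    fun s n hn => ?_⟩
  · by_contra! hlt
    refine hn ?_
    have hc : (n : ℚ) < c :=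
      (Int.cast_lt.2 (hlt.trans_le (min_le_left _ _))).trans_le (Int.floor_le c)
    refine (hstable n 0 (by simpa using hc)).trans ?_
    exact coeff_eq_zero_of_lt_order (hlt.trans_le (min_le_right _ _))
  · rw [coeff_sub, sub_eq_zero]
    exact hstable n s hn

/-- A self-map of families of Laurent series of orders at least `c i` that improves every
congruence by `δ > 0`. -/
structure IsOrderContraction {ι : Type*} (F : (ι → LaurentSeries R) → ι → LaurentSeries R)
    (c : ι → ℚ) (δ : ℚ) : Prop where
  pos : 0 < δ
  map_mem : ∀ ⦃f⦄, (∀ i, f i ∈ orderGE (c i)) → ∀ i, F f i ∈ orderGE (c i)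
  map_sub_mem : ∀ ⦃f g⦄, (∀ i, f i ∈ orderGE (c i)) → (∀ i, g i ∈ orderGE (c i)) →
    ∀ ⦃D⦄, (∀ i, f i - g i ∈ orderGE (c i + D)) → ∀ i, F f i - F g i ∈ orderGE (c i + (D + δ))

namespace IsOrderContraction

variable {ι : Type*} {F : (ι → LaurentSeries R) → ι → LaurentSeries R} {c : ι → ℚ} {δ : ℚ}

theorem iterate_mem (hF : IsOrderContraction F c δ) (s : ℕ) (i : ι) :
    F^[s] 0 i ∈ orderGE (c i) := by
  induction s generalizing i with
  | zero => exact zero_mem _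
  | succ s ih => rw [Function.iterate_succ_apply']; exact hF.map_mem ih i

theorem iterate_succ_sub_mem (hF : IsOrderContraction F c δ) (s : ℕ) (i : ι) :
    F^[s + 1] 0 i - F^[s] 0 i ∈ orderGE (c i + s * δ) := by
  induction s generalizing i with
  | zero => simpa using hF.iterate_mem 1 i
  | succ s ih =>
    rw [Function.iterate_succ_apply' F (s + 1), Function.iterate_succ_apply' F s]
    convert hF.map_sub_mem (hF.iterate_mem (s + 1)) (hF.iterate_mem s) ih i using 2
    · push_cast; ring
    · rw [Function.iterate_succ_apply']

theorem exists_fixedPoint (hF : IsOrderContraction F c δ) :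
    ∃ f, F f = f ∧ (∀ i, f i ∈ orderGE (c i)) ∧
      ∀ (s : ℕ) i, f i - F^[s] 0 i ∈ orderGE (c i + s * δ) := by
  choose f hf using fun i =>
    exists_limit_of_sub_mem_orderGE (f := fun s => F^[s] 0 i) hF.pos
      fun s => hF.iterate_succ_sub_mem s i
  have hmem : ∀ i, f i ∈ orderGE (c i) := fun i => by simpa using hf i 0
  refine ⟨f, funext fun i => ?_, hmem, fun s i => hf i s⟩
  rw [← sub_eq_zero]
  refine eq_zero_of_forall_mem_orderGE hF.pos (c := c i) fun s => ?_
  have hnext : F f i - F^[s + 1] 0 i ∈ orderGE (c i + (s * δ + δ)) := by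
    rw [Function.iterate_succ_apply']
    exact hF.map_sub_mem hmem (hF.iterate_mem s) (fun i => hf i s) i
  have hlim : f i - F^[s + 1] 0 i ∈ orderGE (c i + (s * δ + δ)) := by
    convert hf i (s + 1) using 2; push_cast; ring
  rw [← sub_sub_sub_cancel_right _ _ (F^[s + 1] 0 i)]
  exact orderGE_antitone (by linarith [hF.pos]) (sub_mem hnext hlim)

end IsOrderContraction

theorem dilate_mem_orderGE {f : LaurentSeries ℂ} (hf : f ∈ orderGE c) (q : ℂˣ) :
    dilate q f ∈ orderGE c := fun n hn => by
  rw [dilate_coeff, hf n hn, mul_zero]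

end OrderFiltration

section WeightedNorm

open HahnSeries

/-- The weighted `ℓ¹` norm `∑ ‖fₙ‖ rⁿ`, a submultiplicative norm on the Laurent series that converge
at radius `r`. Real exponents are used so that it can be compared with `r ^ c` for rational `c`. -/
noncomputable def weightedNorm {R : Type*} [NormedRing R] (r : ℝ≥0∞) (f : LaurentSeries R) :
    ℝ≥0∞ :=
  ∑' n : ℤ, ‖f.coeff n‖ₑ * r ^ (n : ℝ)

section NormedRing

variable {R : Type*} [NormedRing R] {r : ℝ≥0∞} {f g : LaurentSeries R} {c : ℚ}

theorem weightedNorm_zero (r : ℝ≥0∞) : weightedNorm r (0 : LaurentSeries R) = 0 := by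
  simp [weightedNorm]

theorem weightedNorm_add_le (r : ℝ≥0∞) (f g : LaurentSeries R) :
    weightedNorm r (f + g) ≤ weightedNorm r f + weightedNorm r g := by
  rw [weightedNorm, weightedNorm, weightedNorm, ← ENNReal.tsum_add]
  refine ENNReal.tsum_le_tsum fun n => ?_
  rw [← add_mul, coeff_add]
  gcongr
  exact enorm_add_le _ _

theorem weightedNorm_sub_le (r : ℝ≥0∞) (f g : LaurentSeries R) :
    weightedNorm r (f - g) ≤ weightedNorm r f + weightedNorm r g := by
  rw [weightedNorm, weightedNorm, weightedNorm, ← ENNReal.tsum_add]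
  refine ENNReal.tsum_le_tsum fun n => ?_
  rw [← add_mul, coeff_sub]
  gcongr
  exact enorm_sub_le

theorem weightedNorm_sum_le {ι : Type*} (r : ℝ≥0∞) (s : Finset ι) (f : ι → LaurentSeries R) :
    weightedNorm r (∑ i ∈ s, f i) ≤ ∑ i ∈ s, weightedNorm r (f i) :=
  Finset.le_sum_of_subadditive _ (weightedNorm_zero r).le (weightedNorm_add_le r) s f

theorem enorm_coeff_mul_le (f g : LaurentSeries R) (n : ℤ) :
    ‖(f * g).coeff n‖ₑ ≤ ∑' a : ℤ, ‖f.coeff a‖ₑ * ‖g.coeff (n - a)‖ₑ := by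
  have hsnd : ∀ x ∈ Finset.antidiagonal f.isPWO_support g.isPWO_support n, x.2 = n - x.1 :=
    fun x hx => eq_sub_of_add_eq' (Finset.mem_antidiagonal.1 hx).2.2
  calc ‖(f * g).coeff n‖ₑ
      ≤ ∑ x ∈ Finset.antidiagonal f.isPWO_support g.isPWO_support n,
          ‖f.coeff x.1‖ₑ * ‖g.coeff (n - x.1)‖ₑ := by
        rw [coeff_mul]
        refine (enorm_sum_le _ _).trans (Finset.sum_le_sum fun x hx => ?_)
        rw [← hsnd x hx]
        exact (ENNReal.coe_le_coe.2 (nnnorm_mul_le _ _)).trans_eq (ENNReal.coe_mul _ _)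
    _ = ∑ a ∈ (Finset.antidiagonal f.isPWO_support g.isPWO_support n).image Prod.fst,
          ‖f.coeff a‖ₑ * ‖g.coeff (n - a)‖ₑ := by
        refine (Finset.sum_image (f := fun a => ‖f.coeff a‖ₑ * ‖g.coeff (n - a)‖ₑ)
          fun x hx y hy hxy => Prod.ext hxy ?_).symm
        rw [hsnd x hx, hsnd y hy, hxy]
    _ ≤ _ := ENNReal.sum_le_tsum _

theorem weightedNorm_mul_le (hr0 : r ≠ 0) (hr : r ≠ ∞) (f g : LaurentSeries R) :
    weightedNorm r (f * g) ≤ weightedNorm r f * weightedNorm r g := by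
  have hsplit : ∀ n a : ℤ, r ^ (n : ℝ) = r ^ (a : ℝ) * r ^ ((n - a : ℤ) : ℝ) := fun n a => by
    rw [← ENNReal.rpow_add _ _ hr0 hr]; push_cast; rw [add_sub_cancel]
  calc weightedNorm r (f * g)
      ≤ ∑' n : ℤ, (∑' a : ℤ, ‖f.coeff a‖ₑ * ‖g.coeff (n - a)‖ₑ) * r ^ (n : ℝ) :=
        ENNReal.tsum_le_tsum fun n => by gcongr; exact enorm_coeff_mul_le f g n
    _ = ∑' (n : ℤ) (a : ℤ), (‖f.coeff a‖ₑ * r ^ (a : ℝ)) *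
          (‖g.coeff (n - a)‖ₑ * r ^ ((n - a : ℤ) : ℝ)) := by
        refine tsum_congr fun n => ?_
        rw [← ENNReal.tsum_mul_right]
        exact tsum_congr fun a => by rw [hsplit n a]; ring
    _ = ∑' (a : ℤ) (n : ℤ), (‖f.coeff a‖ₑ * r ^ (a : ℝ)) *
          (‖g.coeff (n - a)‖ₑ * r ^ ((n - a : ℤ) : ℝ)) := ENNReal.tsum_comm
    _ = ∑' a : ℤ, (‖f.coeff a‖ₑ * r ^ (a : ℝ)) * weightedNorm r g := by
        refine tsum_congr fun a => ?_
        rw [ENNReal.tsum_mul_left]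
        congr 1
        exact (Equiv.subRight a).tsum_eq fun b : ℤ => ‖g.coeff b‖ₑ * r ^ (b : ℝ)
    _ = weightedNorm r f * weightedNorm r g := ENNReal.tsum_mul_right

theorem weightedNorm_le_of_le {s : ℝ≥0∞} (hr0 : r ≠ 0) (hrs : r ≤ s) (hs : s ≠ ∞)
    (hf : f ∈ orderGE c) :
    weightedNorm r f ≤ s ^ (-c : ℝ) * weightedNorm s f * r ^ (c : ℝ) := by
  have hs0 : s ≠ 0 := (pos_iff_ne_zero.2 hr0 |>.trans_le hrs).ne'
  rw [weightedNorm, weightedNorm, ← ENNReal.tsum_mul_left, ← ENNReal.tsum_mul_right]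
  refine ENNReal.tsum_le_tsum fun n => ?_
  by_cases hn : f.coeff n = 0
  · simp [hn]
  have hcn : (0 : ℝ) ≤ n - c := by
    rw [sub_nonneg]
    by_contra! h
    exact hn (hf n (by exact_mod_cast h))
  calc ‖f.coeff n‖ₑ * r ^ (n : ℝ)
      = ‖f.coeff n‖ₑ * (r ^ (n - c : ℝ) * r ^ (c : ℝ)) := by
        rw [← ENNReal.rpow_add _ _ hr0 (ne_top_of_le_ne_top hs hrs), sub_add_cancel]
    _ ≤ ‖f.coeff n‖ₑ * (s ^ (n - c : ℝ) * r ^ (c : ℝ)) := by gcongr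
    _ = s ^ (-c : ℝ) * (‖f.coeff n‖ₑ * s ^ (n : ℝ)) * r ^ (c : ℝ) := by
        rw [sub_eq_neg_add, ENNReal.rpow_add _ _ hs0 hs]; ring

theorem weightedNorm_le_of_sub_mem_orderGE {f : ℕ → LaurentSeries R} {δ : ℚ} {B : ℝ≥0∞}
    (hδ : 0 < δ) (hB : ∀ s, weightedNorm r (f s) ≤ B)
    (h : ∀ s : ℕ, g - f s ∈ orderGE (c + s * δ)) : weightedNorm r g ≤ B := by
  rw [weightedNorm, ENNReal.tsum_eq_iSup_sum]
  refine iSup_le fun T => ?_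
  obtain ⟨N, hN⟩ := T.bddAbove
  obtain ⟨s, hs⟩ := exists_nat_gt ((N - c) / δ)
  rw [div_lt_iff₀ hδ] at hs
  calc ∑ n ∈ T, ‖g.coeff n‖ₑ * r ^ (n : ℝ) = ∑ n ∈ T, ‖(f s).coeff n‖ₑ * r ^ (n : ℝ) := by
        refine Finset.sum_congr rfl fun n hn => ?_
        have hnN : (n : ℚ) ≤ N := by exact_mod_cast hN hn
        rw [coeff_eq_of_sub_mem_orderGE (h s) (by linarith)]
    _ ≤ weightedNorm r (f s) := ENNReal.sum_le_tsum T
    _ ≤ B := hB s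

end NormedRing

variable {f : LaurentSeries ℂ} {c : ℚ}

theorem weightedNorm_dilate_le {u : ℂˣ} (hu : ‖(u : ℂ)‖ ≤ 1) (hf : f ∈ orderGE c) (r : ℝ≥0∞) :
    weightedNorm r (dilate u f) ≤ ‖(u : ℂ) ^ ⌈c⌉‖ₑ * weightedNorm r f := by
  rw [weightedNorm, weightedNorm, ← ENNReal.tsum_mul_left]
  refine ENNReal.tsum_le_tsum fun n => ?_
  by_cases hn : f.coeff n = 0
  · simp [dilate_coeff, hn]
  have hcn : ⌈c⌉ ≤ n := by
    by_contra! h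
    exact hn (hf n (Int.lt_ceil.1 h))
  rw [dilate_coeff, enorm_mul, mul_assoc]
  gcongr
  rw [enorm_le_iff_norm_le, norm_zpow, norm_zpow]
  exact zpow_le_zpow_right_of_le_one₀ (norm_pos_iff.2 u.ne_zero) hu hcn

theorem isConvergent_of_weightedNorm_ne_top {r : ℝ≥0∞} (hr0 : r ≠ 0) (hr : r ≠ ∞)
    (h : weightedNorm r f ≠ ∞) : IsConvergent f := by
  refine ⟨r.toReal, ENNReal.toReal_pos hr0 hr, (ENNReal.summable_toReal h).congr fun n => ?_⟩
  rw [ENNReal.toReal_mul, toReal_enorm, ← ENNReal.toReal_rpow, Real.rpow_intCast]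

theorem IsConvergent.exists_weightedNorm_ne_top (hf : IsConvergent f) :
    ∃ s : ℝ≥0∞, s ≠ 0 ∧ s ≠ ∞ ∧ weightedNorm s f ≠ ∞ := by
  obtain ⟨s, hs, hsum⟩ := hf
  refine ⟨ENNReal.ofReal s, (ENNReal.ofReal_pos.2 hs).ne', ENNReal.ofReal_ne_top, ?_⟩
  convert hsum.tsum_ofReal_ne_top using 1
  refine tsum_congr fun n => ?_
  rw [ENNReal.ofReal_mul (norm_nonneg _), ofReal_norm, ENNReal.ofReal_rpow_of_pos hs,
    Real.rpow_intCast]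

theorem IsConvergent.exists_weightedNorm_le (hf : IsConvergent f) (hc : f ∈ orderGE c) :
    ∃ C ≠ ∞, ∀ᶠ r in 𝓝[>] 0, weightedNorm r f ≤ C * r ^ (c : ℝ) := by
  obtain ⟨s, hs0, hs, hfs⟩ := hf.exists_weightedNorm_ne_top
  refine ⟨s ^ (-c : ℝ) * weightedNorm s f,
    ENNReal.mul_ne_top (ENNReal.rpow_ne_top_of_ne_zero hs0 hs) hfs, ?_⟩
  filter_upwards [Ioo_mem_nhdsGT (pos_iff_ne_zero.2 hs0)] with r hr
  exact weightedNorm_le_of_le hr.1.ne' hr.2.le hs hc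

end WeightedNorm

section FactorizationEquation

open HahnSeries Finset.HasAntidiagonal

/-- The quadratic part of the factorization equation: the coefficient of `Φ ^ n` in
`(∑_{i ≥ 0} γ_{i + k} Φ ^ i) (∑_{j < k} γ_j Φ ^ j)`. The factorization
`(1 + ∑_{i ≥ 0} γ_{i + k} Φ ^ i) (Φ ^ k + ∑_{j < k} γ_j Φ ^ j) = Φ ^ k + ∑ ε_n Φ ^ n` amounts to
`γ n + quadraticPart q k γ n = ε n` for all `n`. -/
noncomputable def quadraticPart (q : ℂˣ) (k : ℕ) (γ : ℕ → LaurentSeries ℂ) (n : ℕ) :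
    LaurentSeries ℂ :=
  ∑ x ∈ antidiagonal n with x.2 < k, γ (x.1 + k) * dilate (q ^ x.1) (γ x.2)

theorem dilate_sub (q : ℂˣ) (f g : LaurentSeries ℂ) :
    dilate q (f - g) = dilate q f - dilate q g := by
  ext n
  simp [dilate_coeff, mul_sub]

variable {q : ℂˣ} {k m : ℕ} {γ γ' ε : ℕ → LaurentSeries ℂ} {c : ℕ → ℚ} {δ : ℚ} {r : ℝ≥0∞}

theorem quadraticPart_eq_zero (h : ∀ n, m < n → γ n = 0) {n : ℕ} (hn : m < n) :
    quadraticPart q k γ n = 0 := by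
  refine Finset.sum_eq_zero fun x hx => ?_
  rw [Finset.mem_filter, mem_antidiagonal] at hx
  rw [h _ (by omega), zero_mul]

theorem quadraticPart_mem_orderGE (hδ : 0 ≤ δ)
    (hc : ∀ i j, j < k → c (i + j) + δ ≤ c (i + k) + c j) (hγ : ∀ n, γ n ∈ orderGE (c n)) (n : ℕ) :
    quadraticPart q k γ n ∈ orderGE (c n) := by
  refine sum_mem fun x hx => ?_
  rw [Finset.mem_filter, mem_antidiagonal] at hx
  refine orderGE_antitone ?_ (mul_mem_orderGE (hγ _) (dilate_mem_orderGE (hγ _) _))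
  rw [← hx.1]
  linarith [hc x.1 x.2 hx.2]

theorem quadraticPart_sub_mem_orderGE
    (hc : ∀ i j, j < k → c (i + j) + δ ≤ c (i + k) + c j) (hγ : ∀ n, γ n ∈ orderGE (c n))
    (hγ' : ∀ n, γ' n ∈ orderGE (c n)) {D : ℚ} (hD : ∀ n, γ n - γ' n ∈ orderGE (c n + D)) (n : ℕ) :
    quadraticPart q k γ n - quadraticPart q k γ' n ∈ orderGE (c n + (D + δ)) := by
  rw [quadraticPart, quadraticPart, ← Finset.sum_sub_distrib]
  refine sum_mem fun x hx => ?_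
  rw [Finset.mem_filter, mem_antidiagonal] at hx
  have hexpand : γ (x.1 + k) * dilate (q ^ x.1) (γ x.2) - γ' (x.1 + k) * dilate (q ^ x.1) (γ' x.2) =
      (γ (x.1 + k) - γ' (x.1 + k)) * dilate (q ^ x.1) (γ x.2) +
        γ' (x.1 + k) * dilate (q ^ x.1) (γ x.2 - γ' x.2) := by
    rw [dilate_sub]; ring
  have hcx := hc x.1 x.2 hx.2
  rw [hexpand, ← hx.1]
  exact add_mem
    (orderGE_antitone (by linarith) (mul_mem_orderGE (hD _) (dilate_mem_orderGE (hγ _) _)))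
    (orderGE_antitone (by linarith) (mul_mem_orderGE (hγ' _) (dilate_mem_orderGE (hD _) _)))

theorem isOrderContraction_sub_quadraticPart (hδ : 0 < δ)
    (hc : ∀ i j, j < k → c (i + j) + δ ≤ c (i + k) + c j) (hε : ∀ n, ε n ∈ orderGE (c n)) :
    IsOrderContraction (fun γ n => ε n - quadraticPart q k γ n) c δ where
  pos := hδ
  map_mem _ hγ n := sub_mem (hε n) (quadraticPart_mem_orderGE hδ.le hc hγ n)
  map_sub_mem _ _ hγ hγ' _ hD n := by
    rw [sub_sub_sub_cancel_left, ← neg_sub]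
    exact neg_mem (quadraticPart_sub_mem_orderGE hc hγ hγ' hD n)

theorem iterate_sub_quadraticPart_eq_zero (hε : ∀ n, m < n → ε n = 0) (s : ℕ) {n : ℕ}
    (hn : m < n) : (fun γ n => ε n - quadraticPart q k γ n)^[s] 0 n = 0 := by
  induction s generalizing n with
  | zero => rfl
  | succ s ih =>
    rw [Function.iterate_succ_apply', hε n hn, quadraticPart_eq_zero (fun _ => ih) hn, sub_zero]

theorem weightedNorm_mul_dilate_le (hq : ‖(q : ℂ)‖ ≤ 1) (hr0 : r ≠ 0) (hr : r ≤ 1) {B : ℝ≥0∞}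
    (hγ : ∀ n, γ n ∈ orderGE (c n)) (hB : ∀ n, weightedNorm r (γ n) ≤ B * r ^ (c n : ℝ))
    {i j : ℕ} (hc : c (i + j) + δ ≤ c (i + k) + c j) :
    weightedNorm r (γ (i + k) * dilate (q ^ i) (γ j)) ≤
      ‖((q ^ i : ℂˣ) : ℂ) ^ ⌈c j⌉‖ₑ * (B ^ 2 * r ^ (δ : ℝ) * r ^ (c (i + j) : ℝ)) := by
  have hrtop : r ≠ ∞ := ne_top_of_le_ne_top ENNReal.one_ne_top hr
  have hqi : ‖((q ^ i : ℂˣ) : ℂ)‖ ≤ 1 := by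
    rw [Units.val_pow_eq_pow_val, norm_pow]
    exact pow_le_one₀ (norm_nonneg _) hq
  set E := ‖((q ^ i : ℂˣ) : ℂ) ^ ⌈c j⌉‖ₑ
  calc weightedNorm r (γ (i + k) * dilate (q ^ i) (γ j))
      ≤ weightedNorm r (γ (i + k)) * (E * weightedNorm r (γ j)) :=
        (weightedNorm_mul_le hr0 hrtop _ _).trans
          (mul_le_mul_right (weightedNorm_dilate_le hqi (hγ j) r) _)
    _ ≤ (B * r ^ (c (i + k) : ℝ)) * (E * (B * r ^ (c j : ℝ))) := by
        gcongr
        exacts [hB _, hB _]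
    _ = E * (B ^ 2 * r ^ (c (i + k) + c j : ℝ)) := by rw [ENNReal.rpow_add _ _ hr0 hrtop]; ring
    _ ≤ E * (B ^ 2 * r ^ (δ + c (i + j) : ℝ)) := by
        gcongr 2
        refine ENNReal.rpow_le_rpow_of_exponent_ge hr ?_
        rw [add_comm]
        exact_mod_cast hc
    _ = E * (B ^ 2 * r ^ (δ : ℝ) * r ^ (c (i + j) : ℝ)) := by
        rw [ENNReal.rpow_add _ _ hr0 hrtop, mul_assoc]

theorem exists_weightedNorm_quadraticPart_le (hq : ‖(q : ℂ)‖ ≤ 1)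
    (hc : ∀ i j, j < k → c (i + j) + δ ≤ c (i + k) + c j) (m : ℕ) :
    ∃ C ≠ ∞, ∀ (r : ℝ≥0∞) (B : ℝ≥0∞) (γ : ℕ → LaurentSeries ℂ), r ≠ 0 → r ≤ 1 →
      (∀ n, m < n → γ n = 0) → (∀ n, γ n ∈ orderGE (c n)) →
      (∀ n, weightedNorm r (γ n) ≤ B * r ^ (c n : ℝ)) →
      ∀ n, weightedNorm r (quadraticPart q k γ n) ≤ C * B ^ 2 * r ^ (δ : ℝ) * r ^ (c n : ℝ) := by
  refine ⟨∑ x ∈ Finset.range (m + 1) ×ˢ Finset.range k, ‖((q ^ x.1 : ℂˣ) : ℂ) ^ ⌈c x.2⌉‖ₑ,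
    ENNReal.sum_ne_top.2 fun _ _ => enorm_ne_top, fun r B γ hr0 hr h0 hγ hB n => ?_⟩
  calc weightedNorm r (quadraticPart q k γ n)
      ≤ ∑ x ∈ antidiagonal n with x.2 < k,
          weightedNorm r (γ (x.1 + k) * dilate (q ^ x.1) (γ x.2)) := weightedNorm_sum_le _ _ _
    _ = ∑ x ∈ antidiagonal n with x.2 < k ∧ x.1 ≤ m,
          weightedNorm r (γ (x.1 + k) * dilate (q ^ x.1) (γ x.2)) := by
        rw [← Finset.filter_filter]
        refine (Finset.sum_filter_of_ne fun x _ hx => ?_).symm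
        contrapose! hx
        rw [h0 _ (by omega), zero_mul, weightedNorm_zero]
    _ ≤ ∑ x ∈ antidiagonal n with x.2 < k ∧ x.1 ≤ m,
          ‖((q ^ x.1 : ℂˣ) : ℂ) ^ ⌈c x.2⌉‖ₑ * (B ^ 2 * r ^ (δ : ℝ) * r ^ (c n : ℝ)) := by
        refine Finset.sum_le_sum fun x hx => ?_
        rw [Finset.mem_filter, mem_antidiagonal] at hx
        rw [← hx.1]
        exact weightedNorm_mul_dilate_le hq hr0 hr hγ hB (hc _ _ hx.2.1)
    _ ≤ ∑ x ∈ Finset.range (m + 1) ×ˢ Finset.range k,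
          ‖((q ^ x.1 : ℂˣ) : ℂ) ^ ⌈c x.2⌉‖ₑ * (B ^ 2 * r ^ (δ : ℝ) * r ^ (c n : ℝ)) := by
        refine Finset.sum_le_sum_of_subset fun x hx => ?_
        rw [Finset.mem_filter] at hx
        simpa [Nat.lt_succ_iff] using hx.2.symm
    _ = _ := by rw [← Finset.sum_mul, mul_assoc, mul_assoc, mul_assoc]

theorem exists_radius (hδ : 0 < δ) (hε0 : ∀ n, m < n → ε n = 0) (hε : ∀ n, ε n ∈ orderGE (c n))
    (hconv : ∀ n, IsConvergent (ε n)) {C : ℝ≥0∞} (hC : C ≠ ∞) :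
    ∃ (A r : ℝ≥0∞), A ≠ ∞ ∧ r ≠ 0 ∧ r ≤ 1 ∧ (∀ n, weightedNorm r (ε n) ≤ A * r ^ (c n : ℝ)) ∧
      C * (2 * A) ^ 2 * r ^ (δ : ℝ) ≤ A := by
  choose D hD hDle using fun n => (hconv n).exists_weightedNorm_le (hε n)
  set A : ℝ≥0∞ := 1 + ∑ n ∈ Finset.range (m + 1), D n
  have hA : A ≠ ∞ :=
    ENNReal.add_ne_top.2 ⟨ENNReal.one_ne_top, ENNReal.sum_ne_top.2 fun n _ => hD n⟩
  have hsmall : ∀ᶠ r in 𝓝[>] (0 : ℝ≥0∞), C * (2 * A) ^ 2 * r ^ (δ : ℝ) < A := by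
    have htendsto : Filter.Tendsto (fun r : ℝ≥0∞ => C * (2 * A) ^ 2 * r ^ (δ : ℝ))
        (𝓝[>] 0) (𝓝 0) := by
      have := ((ENNReal.continuous_rpow_const (y := δ)).tendsto 0).mono_left
        (nhdsWithin_le_nhds (s := Set.Ioi 0))
      rw [ENNReal.zero_rpow_of_pos (by exact_mod_cast hδ)] at this
      simpa using ENNReal.Tendsto.const_mul this (Or.inr (by finiteness : C * (2 * A) ^ 2 ≠ ∞))
    exact htendsto.eventually_lt_const (one_pos.trans_le le_self_add)
  obtain ⟨r, hr, hrs, hrε⟩ := (Filter.Eventually.and (Ioo_mem_nhdsGT one_pos)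
    (hsmall.and ((Filter.eventually_all_finset (Finset.range (m + 1))).2 fun n _ => hDle n))).exists
  refine ⟨A, r, hA, hr.1.ne', hr.2.le, fun n => ?_, hrs.le⟩
  rcases lt_or_ge m n with hn | hn
  · rw [hε0 n hn, weightedNorm_zero]
    exact zero_le
  · have hmem : n ∈ Finset.range (m + 1) := Finset.mem_range.2 (by omega)
    refine (hrε n hmem).trans (mul_le_mul_left ?_ _)
    exact (Finset.single_le_sum (f := D) (fun _ _ => zero_le) hmem).trans le_add_self

theorem exists_add_quadraticPart_eq (hq : ‖(q : ℂ)‖ ≤ 1) (hδ : 0 < δ)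
    (hc : ∀ i j, j < k → c (i + j) + δ ≤ c (i + k) + c j) (hε0 : ∀ n, m < n → ε n = 0)
    (hε : ∀ n, ε n ∈ orderGE (c n)) (hconv : ∀ n, IsConvergent (ε n)) :
    ∃ γ : ℕ → LaurentSeries ℂ, (∀ n, m < n → γ n = 0) ∧ (∀ n, γ n ∈ orderGE (c n)) ∧
      (∀ n, IsConvergent (γ n)) ∧ ∀ n, γ n + quadraticPart q k γ n = ε n := by
  have hF := isOrderContraction_sub_quadraticPart (q := q) hδ hc hε
  set F : (ℕ → LaurentSeries ℂ) → ℕ → LaurentSeries ℂ := fun γ n => ε n - quadraticPart q k γ n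
  have hzero (s n : ℕ) (hn : m < n) : F^[s] 0 n = 0 := iterate_sub_quadraticPart_eq_zero hε0 s hn
  obtain ⟨γ, hfix, hγ, hlim⟩ := hF.exists_fixedPoint
  obtain ⟨C, hC, hquad⟩ := exists_weightedNorm_quadraticPart_le hq hc m
  obtain ⟨A, r, hA, hr0, hr1, hεr, hsmall⟩ := exists_radius hδ hε0 hε hconv hC
  have hr : r ≠ ∞ := ne_top_of_le_ne_top ENNReal.one_ne_top hr1
  have hbound (s n : ℕ) : weightedNorm r (F^[s] 0 n) ≤ 2 * A * r ^ (c n : ℝ) := by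
    induction s generalizing n with
    | zero => exact (weightedNorm_zero r).trans_le zero_le
    | succ s ih =>
      rw [Function.iterate_succ_apply', two_mul, add_mul]
      refine (weightedNorm_sub_le _ _ _).trans (add_le_add (hεr n) ?_)
      exact (hquad r _ _ hr0 hr1 (hzero s) (hF.iterate_mem s) ih n).trans (by gcongr)
  refine ⟨γ, fun n hn => ?_, hγ, fun n => ?_, fun n => ?_⟩
  · refine eq_zero_of_forall_mem_orderGE hδ (c := c n) fun s => ?_
    simpa [hzero s n hn] using hlim s n
  · refine isConvergent_of_weightedNorm_ne_top hr0 hr (ne_top_of_le_ne_top ?_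
      (weightedNorm_le_of_sub_mem_orderGE hδ (fun s => hbound s n) fun s => hlim s n))
    have := ENNReal.rpow_ne_top_of_ne_zero hr0 hr (y := c n)
    finiteness
  · exact eq_sub_iff_add_eq.1 (congrFun hfix n).symm

end FactorizationEquation

section CyclicVector

variable {K V : Type*} [Field K] [AddCommGroup V] [Module K V]

theorem linearDeriv_eq_zero_of_infinite {ι : Type*} [Fintype ι] [DecidableEq ι]
    (A : MultilinearMap K (fun _ : ι => V) K) {x y : ι → V}
    (h : {c : K | A (x + c • y) = 0}.Infinite) : A.linearDeriv x y = 0 := by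
  let P : K[X] := .C (A x) + .C (A.linearDeriv x y) * .X +
    ∑ s : Finset ι with 2 ≤ s.card, .C (A (s.piecewise y x)) * .X ^ s.card
  have hpiecewise (c : K) (s : Finset ι) :
      A (s.piecewise (c • y) x) = A (s.piecewise y x) * c ^ s.card := by
    have hsmul : s.piecewise (c • y) x =
        s.piecewise (fun i => c • s.piecewise y x i) (s.piecewise y x) := by
      ext i
      by_cases hi : i ∈ s <;> simp [hi]
    rw [hsmul, A.map_piecewise_smul (fun _ => c), Finset.prod_const, smul_eq_mul, mul_comm]
  have heval (c : K) : P.eval c = A (x + c • y) := by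
    simp only [P, A.map_add_eq_map_add_linearDeriv_add, hpiecewise, Polynomial.eval_add,
      Polynomial.eval_C, Polynomial.eval_mul, Polynomial.eval_X, Polynomial.eval_finsetSum,
      Polynomial.eval_pow, map_smul, smul_eq_mul, mul_comm c]
  have hP : P = 0 :=
    P.eq_zero_of_infinite_isRoot (h.mono fun c hc => (heval c).trans hc)
  have hcoeff : P.coeff 1 = A.linearDeriv x y := by
    simp only [P, Polynomial.coeff_add, Polynomial.finsetSum_coeff, Polynomial.coeff_C_mul,
      Polynomial.coeff_X_pow, Polynomial.coeff_X_one]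
    rw [Finset.sum_eq_zero fun s hs => ?_]
    · simp
    · rw [if_neg (by have := (Finset.mem_filter.1 hs).2; omega), mul_zero]
  rw [← hcoeff, hP, Polynomial.coeff_zero]

theorem exists_alternatingMap_apply_eq_one {n : ℕ} {v : Fin n → V} (hv : LinearIndependent K v) :
    ∃ A : V [⋀^Fin n]→ₗ[K] K, A v = 1 := by
  obtain ⟨g, hg⟩ := LinearMap.exists_leftInverse_of_injective (Fintype.linearCombination K v)
    (LinearMap.ker_eq_bot.2 hv.fintypeLinearCombination_injective)
  have hgv : (fun i => g (v i)) = (1 : Matrix (Fin n) (Fin n) K) := by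
    ext i j
    have := congrFun (LinearMap.congr_fun hg (Pi.single i 1)) j
    simpa [Matrix.one_apply, Pi.single_apply, eq_comm] using this
  refine ⟨Matrix.detRowAlternating.compLinearMap g, ?_⟩
  rw [AlternatingMap.compLinearMap_apply, hgv]
  exact Matrix.det_one

variable {σ : K →+* K} (Φ : V →ₛₗ[σ] V)

theorem iterate_smulₛₗ (i : ℕ) (c : K) (x : V) : Φ^[i] (c • x) = (σ ^ i) c • Φ^[i] x := by
  induction i with
  | zero => rfl
  | succ i ih =>
    rw [Function.iterate_succ_apply', ih, map_smulₛₗ, pow_succ', Function.iterate_succ_apply']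
    rfl

theorem pow_apply_mul_of_fixed {c u z : K} (hc : σ c = c) (hu : σ u = u) (hz : σ z = u * z)
    (i k : ℕ) : (σ ^ i) (c * z ^ k) = c * (z ^ k * (u ^ i) ^ k) := by
  induction i with
  | zero => simp
  | succ i ih =>
    have : (σ ^ (i + 1)) (c * z ^ k) = σ ((σ ^ i) (c * z ^ k)) := by rw [pow_succ']; rfl
    rw [this, ih]
    simp only [map_mul, map_pow, hc, hu, hz]
    ring

variable {u z : K} (hfix : {c | σ c = c}.Infinite) (hu : σ u = u)
  (hpow : Function.Injective fun n : ℕ => u ^ n) (hz : σ z = u * z) (hz0 : z ≠ 0)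
include hfix hu hpow hz hz0

/-- Put `e + c z ^ k f` for `e`, with `c` fixed by `σ`. The linear terms in `c` of the resulting
determinantal identities for all `k` form a Vandermonde system. -/
theorem iterate_mem_span_of_forall_not_linearIndependent {d : ℕ} {e : V}
    (he : LinearIndependent K fun i : Fin d => Φ^[i] e)
    (hdep : ∀ e' : V, ¬ LinearIndependent K fun i : Fin (d + 1) => Φ^[i] e') (f : V) :
    Φ^[d] f ∈ Submodule.span K (Set.range fun i : Fin d => Φ^[i] e) := by
  by_contra hf
  let x : Fin (d + 1) → V := fun i => Φ^[i] e
  have hx : LinearIndependent K (Function.update x (Fin.last d) (Φ^[d] f)) := by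
    have hinit : Fin.init (Function.update x (Fin.last d) (Φ^[d] f)) =
        fun i : Fin d => Φ^[i] e := by
      ext i
      simp [Fin.init, x]
    rw [linearIndependent_finSucc', hinit]
    exact ⟨he, by simpa using hf⟩
  obtain ⟨A, hA⟩ := exists_alternatingMap_apply_eq_one hx
  have hlinear (k : ℕ) :
      A.toMultilinearMap.linearDeriv x (fun i => (z ^ k * (u ^ (i : ℕ)) ^ k) • Φ^[i] f) = 0 := by
    refine linearDeriv_eq_zero_of_infinite _ (hfix.mono fun c hc => ?_)
    have hfamily : (x + c • fun i : Fin (d + 1) => (z ^ k * (u ^ (i : ℕ)) ^ k) • Φ^[i] f) =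
        fun i : Fin (d + 1) => Φ^[i] (e + (c * z ^ k) • f) := by
      ext i
      rw [iterate_map_add, iterate_smulₛₗ, pow_apply_mul_of_fixed hc hu hz, mul_smul]
      rfl
    exact A.map_linearDependent _ (hfamily ▸ hdep _)
  have hvandermonde := Matrix.eq_zero_of_forall_pow_sum_mul_pow_eq_zero
    (f := fun i : Fin (d + 1) => u ^ (i : ℕ)) (v := fun i => A (Function.update x i (Φ^[i] f)))
    (hpow.comp Fin.val_injective) fun k => ?_
  · exact one_ne_zero (hA.symm.trans (congrFun hvandermonde (Fin.last d)))
  · refine (mul_eq_zero.1 ?_).resolve_left (pow_ne_zero (k : ℕ) hz0)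
    rw [← hlinear k, MultilinearMap.linearDeriv_apply, Finset.mul_sum]
    refine Finset.sum_congr rfl fun i _ => ?_
    rw [MultilinearMap.map_update_smul, smul_eq_mul, mul_right_comm, mul_assoc]
    rfl

theorem exists_linearIndependent_iterate [FiniteDimensional K V] (hΦ : Function.Surjective Φ)
    {d : ℕ} (hd : d ≤ Module.finrank K V) :
    ∃ e : V, LinearIndependent K fun i : Fin d => Φ^[i] e := by
  induction d with
  | zero => exact ⟨0, linearIndependent_empty_type⟩
  | succ d ih =>
    obtain ⟨e, he⟩ := ih (by omega)
    by_contra! hdep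
    have htop : Submodule.span K (Set.range fun i : Fin d => Φ^[i] e) = ⊤ := by
      refine Submodule.eq_top_iff'.2 fun x => ?_
      obtain ⟨f, rfl⟩ := hΦ.iterate d x
      exact iterate_mem_span_of_forall_not_linearIndependent Φ hfix hu hpow hz hz0 he hdep f
    have hcard := finrank_span_eq_card he
    rw [htop, finrank_top, Fintype.card_fin] at hcard
    omega

end CyclicVector

section NewtonPolygon

/-- Among the lines through the point over `p` and a point further right, take the steepest one and
follow it as far to the right as possible. -/
theorem exists_edge_of_exists_lt {S : Finset ℕ} (h : ℕ → ℚ) {p : ℕ} (hS : ∃ j ∈ S, p < j) :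
    ∃ lam : ℚ, ∃ k ∈ S, p < k ∧ h k + lam * k = h p + lam * p ∧
      (∀ i ∈ S, p < i → h p + lam * p ≤ h i + lam * i) ∧
      ∀ i ∈ S, k < i → h p + lam * p < h i + lam * i := by
  let g : ℕ → ℚ := fun i => (h p - h i) / (i - p)
  have hpos {i : ℕ} (hi : p < i) : (0 : ℚ) < i - p := sub_pos.2 (by exact_mod_cast hi)
  have hg {i : ℕ} (hi : p < i) : h p - h i = g i * (i - p) := (div_mul_cancel₀ _ (hpos hi).ne').symm
  obtain ⟨k, hkS, hmax⟩ := Finset.exists_max_image {i ∈ S | p < i} (fun i => toLex (g i, i))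
    (hS.imp fun j hj => Finset.mem_filter.2 hj)
  rw [Finset.mem_filter] at hkS
  refine ⟨g k, k, hkS.1, hkS.2, ?_, fun i hiS hi => ?_, fun i hiS hki => ?_⟩
  · linarith [hg hkS.2]
  · have hle : g i ≤ g k := Prod.Lex.monotone_fst _ _ (hmax i (Finset.mem_filter.2 ⟨hiS, hi⟩))
    linarith [hg hi, mul_le_mul_of_nonneg_right hle (hpos hi).le]
  · have hi : p < i := hkS.2.trans hki
    have hlt : g i < g k :=
      (Prod.Lex.le_iff.1 (hmax i (Finset.mem_filter.2 ⟨hiS, hi⟩))).resolve_right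
        fun h => hki.not_ge h.2
    linarith [hg hi, mul_lt_mul_of_pos_right hlt (hpos hi)]

theorem mem_newtonSlopes_coeff_iff {L : ConvLaurent[X]} {lam : ℚ} :
    lam ∈ newtonSlopes (fun i : Fin (L.natDegree + 1) => L.coeff i) ↔
      ∃ i ∈ L.support, ∃ j ∈ L.support, i ≠ j ∧
        ord (L.coeff j) + lam * j = ord (L.coeff i) + lam * i ∧
        ∀ k ∈ L.support, ord (L.coeff i) + lam * i ≤ ord (L.coeff k) + lam * k := by
  constructor
  · rintro ⟨h, ⟨i, j, hij, hi, hj, hhi, hhj⟩, hle⟩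
    refine ⟨i, by simpa using hi, j, by simpa using hj, Fin.val_ne_of_ne hij, by linarith,
      fun k hk => ?_⟩
    have := hle ⟨k, Nat.lt_succ_of_le (Polynomial.le_natDegree_of_mem_supp k hk)⟩
      (Polynomial.mem_support_iff.1 hk)
    dsimp only at this
    linarith
  · rintro ⟨i, hi, j, hj, hij, heq, hle⟩
    have hlt {k : ℕ} (hk : k ∈ L.support) : k < L.natDegree + 1 :=
      Nat.lt_succ_of_le (Polynomial.le_natDegree_of_mem_supp k hk)
    refine ⟨ord (L.coeff i) + lam * i, ⟨⟨i, hlt hi⟩, ⟨j, hlt hj⟩, by simpa using hij,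
      Polynomial.mem_support_iff.1 hi, Polynomial.mem_support_iff.1 hj, by simp, by
      dsimp only; linarith⟩, fun k hk => ?_⟩
    linarith [hle k (Polynomial.mem_support_iff.2 hk)]

/-- The subgroup of the operators `∑ aᵢ Φ ^ i` all of whose points `(i, v(aᵢ))` lie on or above the
line `y = c - lam * x`. -/
def gaussGE (lam c : ℚ) : AddSubgroup ConvLaurent[X] where
  carrier := {P | ∀ i : ℕ, (P.coeff i : LaurentSeries ℂ) ∈ orderGE (c - lam * i)}
  zero_mem' i := by simp [zero_mem]
  add_mem' hP hQ i := by simpa using add_mem (hP i) (hQ i)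
  neg_mem' hP i := by simpa using hP i

theorem mem_gaussGE_iff {lam c : ℚ} {P : ConvLaurent[X]} :
    P ∈ gaussGE lam c ↔ ∀ i ∈ P.support, c ≤ ord (P.coeff i) + lam * i := by
  refine forall_congr' fun i => ?_
  rw [Polynomial.mem_support_iff]
  by_cases hi : P.coeff i = 0
  · simp [hi, zero_mem]
  · rw [mem_orderGE_iff_order (by simpa using hi), ord, sub_le_iff_le_add, imp_iff_right hi]

/-- A monic operator of positive degree whose Newton polygon is a single edge of slope `lam`,
starting over `0`. -/
structure IsPureOperator (lam : ℚ) (L : ConvLaurent[X]) : Prop where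
  monic : L.Monic
  natDegree_pos : 0 < L.natDegree
  coeff_zero_ne_zero : L.coeff 0 ≠ 0
  ord_coeff_zero : (ord (L.coeff 0) : ℚ) = lam * L.natDegree
  mem_gaussGE : L ∈ gaussGE lam (lam * L.natDegree)

theorem ord_coeff_natDegree {L : ConvLaurent[X]} (hL : L.Monic) :
    ord (L.coeff L.natDegree) = 0 := by
  rw [hL.coeff_natDegree]
  exact HahnSeries.order_one

theorem inv_mem_orderGE {a : ConvLaurent} (ha : a ≠ 0) :
    ((a⁻¹ : ConvLaurent) : LaurentSeries ℂ) ∈ orderGE (-ord a) := by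
  have ha' : (a : LaurentSeries ℂ) ≠ 0 := by simpa using ha
  have hinv : (a : LaurentSeries ℂ).order + (a : LaurentSeries ℂ)⁻¹.order = 0 := by
    rw [← HahnSeries.order_mul ha' (inv_ne_zero ha'), mul_inv_cancel₀ ha', HahnSeries.order_one]
  rw [Subfield.coe_inv, mem_orderGE_iff_order (inv_ne_zero ha'), ord,
    eq_neg_of_add_eq_zero_right hinv, Int.cast_neg]

theorem IsPureOperator.newtonSlopes_eq {lam : ℚ} {L : ConvLaurent[X]} (hL : IsPureOperator lam L) :
    newtonSlopes (fun i : Fin (L.natDegree + 1) => L.coeff i) = {lam} := by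
  have hm := ord_coeff_natDegree hL.monic
  have h0 := hL.ord_coeff_zero
  have h0S : 0 ∈ L.support := Polynomial.mem_support_iff.2 hL.coeff_zero_ne_zero
  have hmS : L.natDegree ∈ L.support :=
    Polynomial.natDegree_mem_support_of_nonzero hL.monic.ne_zero
  have hle := mem_gaussGE_iff.1 hL.mem_gaussGE
  ext l
  rw [mem_newtonSlopes_coeff_iff, Set.mem_singleton_iff]
  constructor
  · rintro ⟨i, hi, j, hj, hij, heq, hmin⟩
    wlog hlt : i < j generalizing i j
    · exact this j hj i hi hij.symm heq.symm (fun k hk => heq.trans_le (hmin k hk)) (by omega)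
    have hij' : (i : ℚ) < j := by exact_mod_cast hlt
    have hjm : (j : ℚ) ≤ L.natDegree := by
      exact_mod_cast Polynomial.le_natDegree_of_mem_supp j hj
    have hm_le := hmin _ hmS
    have h0_le := hmin _ h0S
    rw [hm] at hm_le
    rw [h0] at h0_le
    push_cast at hm_le h0_le
    rcases lt_trichotomy l lam with hl | hl | hl
    · nlinarith [hle i hi, hle j hj, mul_pos (sub_pos.2 hl) (sub_pos.2 (hij'.trans_le hjm))]
    · exact hl
    · nlinarith [hle i hi, hle j hj, mul_pos (sub_pos.2 hl) ((Nat.cast_nonneg i).trans_lt hij')]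
  · rintro rfl
    refine ⟨0, h0S, L.natDegree, hmS, hL.natDegree_pos.ne, ?_, fun k hk => ?_⟩
    · rw [hm, h0]; simp
    · rw [h0]; simpa using hle k hk

theorem exists_lt_edge_of_forall_le {S : Finset ℕ} (v : ℕ → ℚ) {l : ℚ} {k : ℕ}
    (hle : ∀ i ∈ S, v k + l * k ≤ v i + l * i) (hlt : ∀ i ∈ S, k < i → v k + l * k < v i + l * i)
    (hS : ∃ j ∈ S, k < j) :
    ∃ l' < l, ∃ j ∈ S, k < j ∧ v j + l' * j = v k + l' * k ∧
      ∀ i ∈ S, v k + l' * k ≤ v i + l' * i := by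
  obtain ⟨l', j, hjS, hj, hjeq, hle', -⟩ := exists_edge_of_exists_lt v hS
  have hl' : l' < l := by
    have hkj : (k : ℚ) < j := by exact_mod_cast hj
    have := hlt j hjS hj
    exact lt_of_mul_lt_mul_right (a := (j - k : ℚ)) (by linarith) (by linarith)
  refine ⟨l', hl', j, hjS, hj, hjeq, fun i hi => ?_⟩
  rcases lt_trichotomy i k with hik | rfl | hik
  · have hik' : (i : ℚ) < k := by exact_mod_cast hik
    have := mul_lt_mul_of_pos_right hl' (sub_pos.2 hik')
    have := hle i hi
    linarith
  · exact le_rfl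
  · exact hle' i hi hik

theorem isPureOperator_of_newtonSlopes_eq {lam : ℚ} {L : ConvLaurent[X]} (hL : L.Monic)
    (h0 : L.coeff 0 ≠ 0)
    (h : newtonSlopes (fun i : Fin (L.natDegree + 1) => L.coeff i) = {lam}) :
    IsPureOperator lam L := by
  have hmem {l : ℚ} := mem_newtonSlopes_coeff_iff (L := L) (lam := l)
  simp only [h, Set.mem_singleton_iff] at hmem
  have h0S : 0 ∈ L.support := Polynomial.mem_support_iff.2 h0
  have hmS : L.natDegree ∈ L.support := Polynomial.natDegree_mem_support_of_nonzero hL.ne_zero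
  have hpos : 0 < L.natDegree := by
    obtain ⟨i, hi, j, hj, hij, -⟩ := hmem.1 rfl
    have := Polynomial.le_natDegree_of_mem_supp i hi
    have := Polynomial.le_natDegree_of_mem_supp j hj
    omega
  let v : ℕ → ℚ := fun i => ord (L.coeff i)
  obtain ⟨l, k, hkS, hk, hkeq, hle, hlt⟩ := exists_edge_of_exists_lt v ⟨_, hmS, hpos⟩
  have hmin (i : ℕ) (hi : i ∈ L.support) : v 0 + l * (0 : ℕ) ≤ v i + l * i := by
    rcases i.eq_zero_or_pos with rfl | hi0
    exacts [le_rfl, hle i hi hi0]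
  obtain rfl : l = lam := hmem.2 ⟨0, h0S, k, hkS, hk.ne, hkeq, hmin⟩
  obtain rfl : k = L.natDegree := by
    by_contra hne
    have hkm := (Polynomial.le_natDegree_of_mem_supp k hkS).lt_of_ne hne
    obtain ⟨l', hl', j, hjS, hj, hjeq, hle'⟩ := exists_lt_edge_of_forall_le v
      (fun i hi => hkeq.le.trans (hmin i hi)) (fun i hi hi' => hkeq.le.trans_lt (hlt i hi hi'))
      ⟨_, hmS, hkm⟩
    exact hl'.ne (hmem.2 ⟨k, hkS, j, hjS, hj.ne, hjeq, hle'⟩)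
  have h0eq : v 0 = l * L.natDegree := by
    have hvm : v L.natDegree = 0 := Int.cast_eq_zero.2 (ord_coeff_natDegree hL)
    rw [hvm] at hkeq
    simpa using hkeq.symm
  exact ⟨hL, hpos, h0, h0eq, mem_gaussGE_iff.2 fun i hi => by simpa [h0eq] using hmin i hi⟩

end NewtonPolygon

section DifferenceOperators

variable {K M M' : Type*} [Field K] [AddCommGroup M] [Module K M] [AddCommGroup M'] [Module K M']
  {σ : K →+* K} {Ψ : M' →ₛₗ[σ] M'} {Φ : M →ₛₗ[σ] M}

/-- The vector `∑ aᵢ Φ ^ i x` obtained by applying the operator `∑ aᵢ Φ ^ i` to `x`. The operator is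
recorded as the polynomial `∑ aᵢ X ^ i`. -/
noncomputable def operatorEval (Φ : M →ₛₗ[σ] M) (x : M) : K[X] →ₗ[K] M :=
  Polynomial.lsum fun i => LinearMap.toSpanSingleton K M (Φ^[i] x)

theorem operatorEval_apply (x : M) (P : K[X]) :
    operatorEval Φ x P = P.sum fun i a => a • Φ^[i] x := rfl

theorem operatorEval_monomial (x : M) (i : ℕ) (a : K) :
    operatorEval Φ x (.monomial i a) = a • Φ^[i] x := by
  rw [operatorEval_apply, Polynomial.sum_monomial_index _ _ (zero_smul K _)]

theorem operatorEval_one (x : M) : operatorEval Φ x 1 = x := by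
  rw [← Polynomial.monomial_zero_one, operatorEval_monomial, one_smul, Function.iterate_zero_apply]

theorem operatorEval_zero (P : K[X]) : operatorEval Φ 0 P = 0 := by
  simp [operatorEval_apply, Polynomial.sum_def]

theorem map_operatorEval {g : M →ₗ[K] M'} (hg : ∀ y, g (Φ y) = Ψ (g y)) (x : M) (P : K[X]) :
    g (operatorEval Φ x P) = operatorEval Ψ (g x) P := by
  have hiter (i : ℕ) : g (Φ^[i] x) = Ψ^[i] (g x) := (Function.Semiconj.iterate_right hg i) x
  simp only [operatorEval_apply, Polynomial.sum_def, map_sum, map_smul, hiter]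

variable (σ) in
/-- Left multiplication by `Φ` on operators, where `Φ a = σ(a) Φ`. It makes the ring of operators
the free difference module on the operator `1`. -/
noncomputable def shiftOperator : K[X] →ₛₗ[σ] K[X] where
  toFun P := .X * P.map σ
  map_add' P Q := by rw [Polynomial.map_add, mul_add]
  map_smul' a P := by rw [Polynomial.map_smul, mul_smul_comm]

theorem iterate_shiftOperator (i : ℕ) (P : K[X]) :
    (shiftOperator σ)^[i] P = .X ^ i * P.map (σ ^ i) := by
  induction i with
  | zero => exact ((one_mul _).trans Polynomial.map_id).symm
  | succ i ih =>
    rw [Function.iterate_succ_apply', ih, pow_succ' σ, pow_succ']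
    simp only [shiftOperator, LinearMap.coe_mk, AddHom.coe_mk, Polynomial.map_mul,
      Polynomial.map_pow, Polynomial.map_X, Polynomial.map_map, mul_assoc]
    rfl

theorem operatorEval_shiftOperator (x : M) (P : K[X]) :
    operatorEval Φ x (shiftOperator σ P) = Φ (operatorEval Φ x P) := by
  induction P using Polynomial.induction_on' with
  | add P Q hP hQ => rw [map_add, map_add, hP, hQ, map_add, map_add]
  | monomial i a =>
    have hshift : shiftOperator σ (.monomial i a) = .monomial (i + 1) (σ a) := by
      simp [shiftOperator, Polynomial.X_mul_monomial]
    rw [hshift, operatorEval_monomial, operatorEval_monomial, map_smulₛₗ,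
      Function.iterate_succ_apply']

variable (σ) in
/-- The product `A B` of operators, where `Φ a = σ(a) Φ`. -/
noncomputable def skewMul (A B : K[X]) : K[X] := operatorEval (shiftOperator σ) B A

theorem operatorEval_skewMul (x : M) (A B : K[X]) :
    operatorEval Φ x (skewMul σ A B) = operatorEval Φ (operatorEval Φ x B) A :=
  map_operatorEval (operatorEval_shiftOperator x) B A

theorem coeff_skewMul (A B : K[X]) (n : ℕ) :
    (skewMul σ A B).coeff n =
      ∑ x ∈ Finset.HasAntidiagonal.antidiagonal n, A.coeff x.1 * (σ ^ x.1) (B.coeff x.2) := by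
  rw [Finset.Nat.sum_antidiagonal_eq_sum_range_succ_mk, skewMul, operatorEval_apply,
    Polynomial.sum_def, Polynomial.finsetSum_coeff]
  simp only [iterate_shiftOperator, Polynomial.coeff_smul, Polynomial.coeff_X_pow_mul',
    Polynomial.coeff_map, smul_eq_mul, mul_ite, mul_zero]
  rw [← Finset.sum_filter]
  refine Finset.sum_subset (fun i hi => ?_) fun i hi hi' => ?_
  · simpa [Nat.lt_succ_iff] using (Finset.mem_filter.1 hi).2
  · have : A.coeff i = 0 := by
      by_contra h
      exact hi' (by simpa [h, Nat.lt_succ_iff] using hi)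
    rw [this, zero_mul]

theorem coeff_skewMul_of_natDegree_le {A B : K[X]} {a b : ℕ} (hA : A.natDegree ≤ a)
    (hB : B.natDegree ≤ b) : (skewMul σ A B).coeff (a + b) = A.coeff a * (σ ^ a) (B.coeff b) := by
  rw [coeff_skewMul, Finset.sum_eq_single (a, b)]
  · rintro ⟨i, j⟩ hij hne
    rw [Finset.HasAntidiagonal.mem_antidiagonal] at hij
    rcases lt_trichotomy i a with hi | rfl | hi
    · rw [Polynomial.coeff_eq_zero_of_natDegree_lt (p := B) (by omega), map_zero, mul_zero]
    · exact absurd (by ext <;> simp; omega) hne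
    · rw [Polynomial.coeff_eq_zero_of_natDegree_lt (p := A) (by omega), zero_mul]
  · exact fun h => absurd (Finset.HasAntidiagonal.mem_antidiagonal.2 (by rfl)) h

theorem degree_skewMul (A B : K[X]) : (skewMul σ A B).degree = A.degree + B.degree := by
  rcases eq_or_ne A 0 with rfl | hA
  · simp [skewMul]
  rcases eq_or_ne B 0 with rfl | hB
  · have : skewMul σ A 0 = 0 := by ext n; simp [coeff_skewMul]
    simp [this]
  rw [Polynomial.degree_eq_natDegree hA, Polynomial.degree_eq_natDegree hB, ← Nat.cast_add]
  refine Polynomial.degree_eq_of_le_of_coeff_ne_zero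
    ((Polynomial.degree_le_iff_coeff_zero _ _).2 fun n hn => ?_) ?_
  · have hn' : A.natDegree + B.natDegree < n := by exact_mod_cast hn
    obtain ⟨b, rfl⟩ := Nat.exists_eq_add_of_le (le_self_add.trans hn'.le)
    rw [coeff_skewMul_of_natDegree_le le_rfl (by omega),
      Polynomial.coeff_eq_zero_of_natDegree_lt (p := B) (by omega), map_zero, mul_zero]
  · rw [coeff_skewMul_of_natDegree_le le_rfl le_rfl]
    exact mul_ne_zero (by simpa using hA) ((map_ne_zero _).2 (by simpa using hB))

theorem natDegree_skewMul {A B : K[X]} (hA : A ≠ 0) (hB : B ≠ 0) :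
    (skewMul σ A B).natDegree = A.natDegree + B.natDegree := by
  refine Polynomial.natDegree_eq_of_degree_eq_some ?_
  rw [degree_skewMul, Polynomial.degree_eq_natDegree hA, Polynomial.degree_eq_natDegree hB,
    Nat.cast_add]

theorem leadingCoeff_skewMul {A B : K[X]} (hA : A ≠ 0) (hB : B ≠ 0) :
    (skewMul σ A B).leadingCoeff =
      A.leadingCoeff * (σ ^ A.natDegree) B.leadingCoeff := by
  rw [Polynomial.leadingCoeff, natDegree_skewMul hA hB,
    coeff_skewMul_of_natDegree_le le_rfl le_rfl]
  rfl

theorem exists_eq_skewMul_add {B : K[X]} (hB : B.Monic) {W : AddSubgroup K[X]}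
    (hW : ∀ P ∈ W, ∀ i, skewMul σ (.monomial i (P.coeff (i + B.natDegree))) B ∈ W) {P : K[X]}
    (hP : P ∈ W) : ∃ Q, ∃ R ∈ W, R.degree < B.degree ∧ P = skewMul σ Q B + R := by
  obtain ⟨n, hn⟩ : ∃ n : ℕ, P.degree < (n + B.natDegree : ℕ) :=
    ⟨P.natDegree + 1, Polynomial.degree_le_natDegree.trans_lt (by exact_mod_cast (by omega))⟩
  induction n generalizing P with
  | zero =>
    rw [zero_add, ← Polynomial.degree_eq_natDegree hB.ne_zero] at hn
    exact ⟨0, P, hP, hn, by simp [skewMul]⟩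
  | succ n ih =>
    set T := Polynomial.monomial n (P.coeff (n + B.natDegree))
    have hT : T.natDegree ≤ n := Polynomial.natDegree_monomial_le _
    have hlt : (P - skewMul σ T B).degree < (n + B.natDegree : ℕ) := by
      refine (Polynomial.degree_lt_iff_coeff_zero _ _).2 fun k hk => ?_
      obtain ⟨j, rfl⟩ := Nat.exists_eq_add_of_le (le_add_self.trans hk)
      rw [add_comm B.natDegree, Polynomial.coeff_sub,
        coeff_skewMul_of_natDegree_le (hT.trans (by omega)) le_rfl, hB.coeff_natDegree, map_one,
        mul_one]
      rcases eq_or_ne n j with rfl | hne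
      · rw [Polynomial.coeff_monomial_same, sub_self]
      · rw [Polynomial.coeff_monomial_of_ne _ hne.symm, sub_zero]
        exact (Polynomial.degree_lt_iff_coeff_zero _ _).1 hn _ (by omega)
    obtain ⟨Q, R, hR, hRB, heq⟩ := ih (sub_mem hP (hW P hP n)) hlt
    refine ⟨Q + T, R, hR, hRB, ?_⟩
    rw [skewMul, map_add, ← skewMul, ← skewMul, add_right_comm, ← heq, sub_add_cancel]

theorem operatorEval_eq_linearCombination (x : M) {n : ℕ} (P : Polynomial.degreeLT K n) :
    operatorEval Φ x P =
      Fintype.linearCombination K (fun i : Fin n => Φ^[i] x) (Polynomial.degreeLTEquiv K n P) := by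
  rw [operatorEval_apply, Fintype.linearCombination_apply]
  exact (Polynomial.sum_fin (fun i a => a • Φ^[i] x) (fun i => zero_smul K (Φ^[i] x))
    (Polynomial.mem_degreeLT.1 P.2)).symm

theorem linearIndependent_iterate_iff {x : M} {n : ℕ} :
    LinearIndependent K (fun i : Fin n => Φ^[i] x) ↔
      ∀ P : K[X], P.degree < n → operatorEval Φ x P = 0 → P = 0 := by
  rw [linearIndependent_iff_injective_fintypeLinearCombination,
    injective_iff_map_eq_zero,
    (Polynomial.degreeLTEquiv K n).surjective.forall]
  simp only [← operatorEval_eq_linearCombination, EmbeddingLike.map_eq_zero_iff, Subtype.forall,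
    Polynomial.mem_degreeLT, Submodule.mk_eq_zero]

theorem mem_span_iterate_iff {x y : M} {n : ℕ} :
    y ∈ Submodule.span K (Set.range fun i : Fin n => Φ^[i] x) ↔
      ∃ P : K[X], P.degree < n ∧ operatorEval Φ x P = y := by
  rw [← Fintype.range_linearCombination, LinearMap.mem_range,
    (Polynomial.degreeLTEquiv K n).surjective.exists]
  simp only [← operatorEval_eq_linearCombination, Subtype.exists, Polynomial.mem_degreeLT,
    exists_prop]

end DifferenceOperators

section MinimalOperators

variable {K M : Type*} [Field K] [AddCommGroup M] [Module K M] {σ : K →+* K} {Φ : M →ₛₗ[σ] M}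
  {e : M} {L : K[X]}

theorem exists_shiftOperator_eq (hσ : Function.Surjective σ) {P : K[X]} (hP : P.coeff 0 = 0) :
    ∃ Q, shiftOperator σ Q = P := by
  obtain ⟨Q, hQ⟩ := Polynomial.map_surjective σ hσ P.divX
  refine ⟨Q, ?_⟩
  simpa [shiftOperator, hQ, hP] using Polynomial.X_mul_divX_add P

theorem degree_lt_degree_shiftOperator {P : K[X]} (hP : P ≠ 0) :
    P.degree < (shiftOperator σ P).degree := by
  have h : (shiftOperator σ P).degree = P.degree + 1 := by
    simp [shiftOperator, Polynomial.degree_map, add_comm]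
  rw [h, Polynomial.degree_eq_natDegree hP]
  exact_mod_cast P.natDegree.lt_succ_self

/-- A relation `L e = 0` with nonzero constant coefficient makes `Φ` invertible on the vectors
`P e`. -/
theorem exists_operatorEval_eq_of_operatorEval_eq_map (hσ : Function.Surjective σ)
    (hΦ : Function.Injective Φ) (hL : operatorEval Φ e L = 0) (h0 : L.coeff 0 ≠ 0) {P : K[X]}
    {x : M} (hP : operatorEval Φ e P = Φ x) :
    ∃ Q, shiftOperator σ Q = P - (P.coeff 0 / L.coeff 0) • L ∧ operatorEval Φ e Q = x := by
  obtain ⟨Q, hQ⟩ := exists_shiftOperator_eq hσ (P := P - (P.coeff 0 / L.coeff 0) • L)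
    (by simp [div_mul_cancel₀ _ h0])
  refine ⟨Q, hQ, hΦ ?_⟩
  rw [← operatorEval_shiftOperator, hQ, map_sub, map_smul, hL, smul_zero, sub_zero, hP]

/-- The analogue of the minimal polynomial of an endomorphism: `L` is the monic operator of least
degree that annihilates `e`. -/
structure IsMinimalOperator (Φ : M →ₛₗ[σ] M) (e : M) (L : K[X]) : Prop where
  monic : L.Monic
  operatorEval_eq_zero : operatorEval Φ e L = 0
  eq_zero_of_degree_lt : ∀ P : K[X], P.degree < L.degree → operatorEval Φ e P = 0 → P = 0

theorem isMinimalOperator_iff (hL : L.Monic) :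
    IsMinimalOperator Φ e L ↔
      LinearIndependent K (fun i : Fin L.natDegree => Φ^[i] e) ∧ operatorEval Φ e L = 0 := by
  rw [linearIndependent_iterate_iff, ← Polynomial.degree_eq_natDegree hL.ne_zero]
  exact ⟨fun h => ⟨h.eq_zero_of_degree_lt, h.operatorEval_eq_zero⟩, fun h => ⟨hL, h.2, h.1⟩⟩

theorem exists_isMinimalOperator {m : ℕ} (hli : LinearIndependent K fun i : Fin m => Φ^[i] e)
    (hmem : Φ^[m] e ∈ Submodule.span K (Set.range fun i : Fin m => Φ^[i] e)) :
    ∃ L, IsMinimalOperator Φ e L := by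
  obtain ⟨P, hP, hPe⟩ := mem_span_iterate_iff.1 (neg_mem hmem)
  have hmonic : (.X ^ m + P : K[X]).Monic := Polynomial.monic_X_pow_add hP
  have hdeg : (.X ^ m + P : K[X]).natDegree = m :=
    (Polynomial.natDegree_add_eq_left_of_degree_lt (by simpa using hP)).trans
      (Polynomial.natDegree_X_pow m)
  refine ⟨.X ^ m + P, (isMinimalOperator_iff hmonic).2 ⟨by rwa [hdeg], ?_⟩⟩
  rw [map_add, hPe, ← Polynomial.monomial_one_right_eq_X_pow, operatorEval_monomial, one_smul,
    add_neg_cancel]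

namespace IsMinimalOperator

theorem exists_degree_lt (hL : IsMinimalOperator Φ e L) (P : K[X]) :
    ∃ R : K[X], R.degree < L.degree ∧ operatorEval Φ e R = operatorEval Φ e P := by
  obtain ⟨Q, R, -, hR, rfl⟩ := exists_eq_skewMul_add (σ := σ) (W := ⊤) hL.monic
    (fun _ _ _ => AddSubgroup.mem_top _) (AddSubgroup.mem_top P)
  refine ⟨R, hR, ?_⟩
  rw [map_add, operatorEval_skewMul, hL.operatorEval_eq_zero, operatorEval_zero, zero_add]

theorem span_iterate_eq_range (hL : IsMinimalOperator Φ e L) :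
    Submodule.span K (Set.range fun i : Fin L.natDegree => Φ^[i] e) =
      LinearMap.range (operatorEval Φ e) := by
  ext x
  rw [mem_span_iterate_iff, LinearMap.mem_range,
    ← Polynomial.degree_eq_natDegree hL.monic.ne_zero]
  refine ⟨fun ⟨P, _, hP⟩ => ⟨P, hP⟩, fun ⟨P, hP⟩ => ?_⟩
  obtain ⟨R, hR, hRP⟩ := hL.exists_degree_lt P
  exact ⟨R, hR, hRP.trans hP⟩

theorem coeff_zero_ne_zero (hL : IsMinimalOperator Φ e L) (hσ : Function.Surjective σ)
    (hΦ : Function.Injective Φ) : L.coeff 0 ≠ 0 := by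
  intro h0
  obtain ⟨Q, rfl⟩ := exists_shiftOperator_eq hσ h0
  have hQe : operatorEval Φ e Q = 0 := by
    rw [← map_eq_zero_iff Φ hΦ, ← operatorEval_shiftOperator, hL.operatorEval_eq_zero]
  have hQ : Q ≠ 0 := by
    rintro rfl
    exact hL.monic.ne_zero (map_zero _)
  exact hQ (hL.eq_zero_of_degree_lt Q (degree_lt_degree_shiftOperator hQ) hQe)

variable {A B : K[X]}

theorem skewMul_right (hL : IsMinimalOperator Φ e (skewMul σ A B)) (hB : B.Monic) :
    IsMinimalOperator Φ (operatorEval Φ e B) A where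
  monic := by
    have hA : A ≠ 0 := by
      rintro rfl
      exact hL.monic.ne_zero (by simp [skewMul])
    have h := leadingCoeff_skewMul (σ := σ) hA hB.ne_zero
    rw [hL.monic.leadingCoeff, hB.leadingCoeff, map_one, mul_one] at h
    exact h.symm
  operatorEval_eq_zero := by rw [← operatorEval_skewMul, hL.operatorEval_eq_zero]
  eq_zero_of_degree_lt P hP hPe := by
    have hzero : skewMul σ P B = 0 := by
      refine hL.eq_zero_of_degree_lt _ ?_ (by rw [operatorEval_skewMul, hPe])
      rw [degree_skewMul, degree_skewMul]
      exact WithBot.add_lt_add_right (Polynomial.degree_ne_bot.2 hB.ne_zero) hP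
    have hdeg := degree_skewMul (σ := σ) P B
    rw [hzero, Polynomial.degree_zero, eq_comm, WithBot.add_eq_bot, Polynomial.degree_eq_bot,
      Polynomial.degree_eq_bot] at hdeg
    exact hdeg.resolve_right hB.ne_zero

theorem eq_zero_of_operatorEval_mem_range (hL : IsMinimalOperator Φ e (skewMul σ A B))
    (hB : B.Monic) {P : K[X]} (hP : P.degree < B.degree)
    (hPe : operatorEval Φ e P ∈ LinearMap.range (operatorEval Φ (operatorEval Φ e B))) :
    P = 0 := by
  have hA := hL.skewMul_right hB
  obtain ⟨Q₀, hQ₀⟩ := hPe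
  obtain ⟨Q, hQ, hQe⟩ := hA.exists_degree_lt Q₀
  have hQB : skewMul σ Q B = P := by
    refine sub_eq_zero.1 (hL.eq_zero_of_degree_lt _ ?_ ?_)
    · refine (Polynomial.degree_sub_le _ _).trans_lt (max_lt ?_ ?_)
      · rw [degree_skewMul, degree_skewMul]
        exact WithBot.add_lt_add_right (Polynomial.degree_ne_bot.2 hB.ne_zero) hQ
      · rw [degree_skewMul]
        exact hP.trans_le (le_add_of_nonneg_left
          (Polynomial.zero_le_degree_iff.2 hA.monic.ne_zero))
    · rw [map_sub, operatorEval_skewMul, hQe, hQ₀, sub_self]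
  have hQ0 : Q = 0 := by
    by_contra hQ0
    rw [← hQB, degree_skewMul] at hP
    exact hP.not_ge (le_add_of_nonneg_left (Polynomial.zero_le_degree_iff.2 hQ0))
  rw [← hQB, hQ0, skewMul, map_zero]

end IsMinimalOperator

end MinimalOperators

section GaussLattices

variable {q : ℂˣ} {lam c d : ℚ}

theorem coe_qShift_pow (i : ℕ) (f : ConvLaurent) :
    (((qShift q : ConvLaurent →+* ConvLaurent) ^ i) f : LaurentSeries ℂ) = dilate (q ^ i) f := by
  induction i with
  | zero => simp [dilate_one]
  | succ i ih =>
    rw [pow_succ', pow_succ', ← dilate_dilate, ← ih]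
    rfl

theorem gaussGE_antitone : Antitone (gaussGE lam) :=
  fun _ _ h _ hP i => orderGE_antitone (sub_le_sub_right h _) (hP i)

theorem monomial_mem_gaussGE {i : ℕ} {a : ConvLaurent}
    (ha : (a : LaurentSeries ℂ) ∈ orderGE (c - lam * i)) : .monomial i a ∈ gaussGE lam c := by
  intro j
  rw [Polynomial.coeff_monomial]
  split_ifs with h
  · exact h ▸ ha
  · simp [zero_mem]

theorem skewMul_mem_gaussGE {A B : ConvLaurent[X]} (hA : A ∈ gaussGE lam c)
    (hB : B ∈ gaussGE lam d) : skewMul (qShift q) A B ∈ gaussGE lam (c + d) := by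
  intro n
  rw [coeff_skewMul, AddSubmonoidClass.coe_finsetSum]
  refine sum_mem fun x hx => ?_
  rw [MulMemClass.coe_mul, coe_qShift_pow]
  refine orderGE_antitone (le_of_eq ?_) (mul_mem_orderGE (hA x.1) (dilate_mem_orderGE (hB x.2) _))
  rw [← Finset.HasAntidiagonal.mem_antidiagonal.1 hx]
  push_cast
  ring

theorem smul_mem_gaussGE {a : ConvLaurent} {P : ConvLaurent[X]}
    (ha : (a : LaurentSeries ℂ) ∈ orderGE c) (hP : P ∈ gaussGE lam d) :
    a • P ∈ gaussGE lam (c + d) := by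
  intro n
  rw [Polynomial.coeff_smul, smul_eq_mul, MulMemClass.coe_mul, add_sub_assoc]
  exact mul_mem_orderGE ha (hP n)

theorem shiftOperator_mem_gaussGE_iff {P : ConvLaurent[X]} :
    shiftOperator (qShift q : ConvLaurent →+* ConvLaurent) P ∈ gaussGE lam (c + lam) ↔
      P ∈ gaussGE lam c := by
  have hzero : ((shiftOperator (qShift q : ConvLaurent →+* ConvLaurent) P).coeff 0) = 0 := by
    simp [shiftOperator]
  have hsucc (i : ℕ) : ((shiftOperator (qShift q : ConvLaurent →+* ConvLaurent) P).coeff (i + 1) :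
      LaurentSeries ℂ) = dilate q (P.coeff i) := by
    rw [shiftOperator, LinearMap.coe_mk, AddHom.coe_mk, Polynomial.coeff_X_mul,
      Polynomial.coeff_map]
    rfl
  have hshift (i : ℕ) : c + lam - lam * (i + 1 : ℕ) = c - lam * i := by push_cast; ring
  refine ⟨fun h i => ?_, fun h i => ?_⟩
  · have hi := dilate_mem_orderGE (h (i + 1)) q⁻¹
    rwa [hsucc, dilate_dilate, inv_mul_cancel, dilate_one, hshift] at hi
  · cases i with
    | zero => simp [hzero, zero_mem]
    | succ i =>
      rw [hsucc, hshift]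
      exact dilate_mem_orderGE (h i) q

theorem exists_mem_gaussGE (lam : ℚ) (P : ConvLaurent[X]) : ∃ c, P ∈ gaussGE lam c := by
  obtain ⟨c, hc⟩ := (P.support.image fun i => (ord (P.coeff i) : ℚ) + lam * i).bddBelow
  exact ⟨c, mem_gaussGE_iff.2 fun i hi => hc (Finset.mem_image_of_mem _ hi)⟩

theorem eq_zero_of_forall_mem_gaussGE {P : ConvLaurent[X]} {δ : ℚ} (hδ : 0 < δ)
    (h : ∀ s : ℕ, P ∈ gaussGE lam (c + s * δ)) : P = 0 := by
  ext1 i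
  refine Subtype.ext (eq_zero_of_forall_mem_orderGE (c := c - lam * i) hδ fun s => ?_)
  exact orderGE_antitone (by linarith) (h s i)

theorem IsPureOperator.sub_monomial_zero_mem_gaussGE {L : ConvLaurent[X]}
    (hL : IsPureOperator lam L) {mu : ℚ} (h : lam ≤ mu) :
    L - .monomial 0 (L.coeff 0) ∈ gaussGE mu (lam * L.natDegree + (mu - lam)) := by
  intro i
  cases i with
  | zero => simp [zero_mem]
  | succ i =>
    have hi := mul_nonneg (sub_nonneg.2 h) (Nat.cast_nonneg (α := ℚ) i)
    rw [Polynomial.coeff_sub, Polynomial.coeff_monomial_of_ne _ i.succ_ne_zero, sub_zero]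
    exact orderGE_antitone (by push_cast; linarith) (hL.mem_gaussGE (i + 1))

theorem IsPureOperator.sub_X_pow_mem_gaussGE {L : ConvLaurent[X]} (hL : IsPureOperator lam L)
    {mu : ℚ} (h : mu ≤ lam) :
    L - .X ^ L.natDegree ∈ gaussGE mu (mu * L.natDegree + (lam - mu)) := by
  intro i
  rw [Polynomial.coeff_sub, Polynomial.coeff_X_pow]
  rcases lt_trichotomy i L.natDegree with hi | rfl | hi
  · have hi' : (0 : ℚ) ≤ L.natDegree - (i + 1) := sub_nonneg.2 (by exact_mod_cast hi)
    rw [if_neg hi.ne, sub_zero]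
    exact orderGE_antitone (by linarith [mul_nonneg (sub_nonneg.2 h) hi']) (hL.mem_gaussGE i)
  · simp [hL.monic.coeff_natDegree, zero_mem]
  · simp [Polynomial.coeff_eq_zero_of_natDegree_lt hi, hi.ne', zero_mem]

variable {M : Type*} [AddCommGroup M] [Module ConvLaurent M]
  {Φ : M →ₛₗ[(qShift q : ConvLaurent →+* ConvLaurent)] M} {e x : M} {L : ConvLaurent[X]}

/-- The vectors `P e` with `P` in `gaussGE lam c`. They form a lattice over the ring of power series
if `e` is annihilated by a monic operator that is pure of slope `lam`. -/
noncomputable def gaussLattice (Φ : M →ₛₗ[(qShift q : ConvLaurent →+* ConvLaurent)] M) (e : M)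
    (lam c : ℚ) : AddSubgroup M :=
  (gaussGE lam c).map (operatorEval Φ e).toAddMonoidHom

theorem gaussLattice_antitone : Antitone (gaussLattice Φ e lam) :=
  fun _ _ h => AddSubgroup.map_mono (gaussGE_antitone h)

theorem operatorEval_mem_gaussLattice {P : ConvLaurent[X]} (hP : P ∈ gaussGE lam d)
    (hx : x ∈ gaussLattice Φ e lam c) : operatorEval Φ x P ∈ gaussLattice Φ e lam (d + c) := by
  obtain ⟨Q, hQ, rfl⟩ := hx
  exact ⟨skewMul (qShift q) P Q, skewMul_mem_gaussGE hP hQ, operatorEval_skewMul e P Q⟩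

theorem exists_mem_gaussLattice (lam : ℚ) (hx : x ∈ LinearMap.range (operatorEval Φ e)) :
    ∃ c, x ∈ gaussLattice Φ e lam c := by
  obtain ⟨P, rfl⟩ := hx
  obtain ⟨c, hc⟩ := exists_mem_gaussGE lam P
  exact ⟨c, P, hc, rfl⟩

namespace IsPureOperator

theorem inv_coeff_zero_mem_orderGE (hL : IsPureOperator lam L) :
    (((L.coeff 0)⁻¹ : ConvLaurent) : LaurentSeries ℂ) ∈ orderGE (-(lam * L.natDegree)) := by
  rw [← hL.ord_coeff_zero]
  exact inv_mem_orderGE hL.coeff_zero_ne_zero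

theorem mem_gaussLattice_of_map_mem (hL : IsPureOperator lam L) (hΦ : Function.Injective Φ)
    (he : operatorEval Φ e L = 0) (hx : Φ x ∈ gaussLattice Φ e lam (c + lam)) :
    x ∈ gaussLattice Φ e lam c := by
  obtain ⟨P, hP, hPx⟩ := hx
  obtain ⟨Q, hQ, rfl⟩ := exists_operatorEval_eq_of_operatorEval_eq_map (qShift q).surjective hΦ he
    hL.coeff_zero_ne_zero hPx
  refine ⟨Q, (shiftOperator_mem_gaussGE_iff (q := q)).1 ?_, rfl⟩
  have ha : ((P.coeff 0 / L.coeff 0 : ConvLaurent) : LaurentSeries ℂ) ∈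
      orderGE (c + lam - lam * L.natDegree) := by
    rw [div_eq_mul_inv, MulMemClass.coe_mul]
    simpa [sub_eq_add_neg] using mul_mem_orderGE (hP 0) hL.inv_coeff_zero_mem_orderGE
  rw [hQ]
  exact sub_mem hP (gaussGE_antitone (by linarith) (smul_mem_gaussGE ha hL.mem_gaussGE))

theorem mem_gaussLattice_of_iterate_mem (hL : IsPureOperator lam L) (hΦ : Function.Injective Φ)
    (he : operatorEval Φ e L = 0) {n : ℕ} (hx : Φ^[n] x ∈ gaussLattice Φ e lam (c + lam * n)) :
    x ∈ gaussLattice Φ e lam c := by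
  induction n with
  | zero => simpa using hx
  | succ n ih =>
    refine ih (hL.mem_gaussLattice_of_map_mem hΦ he ?_)
    rw [← Function.iterate_succ_apply' Φ]
    exact gaussLattice_antitone (by push_cast; linarith) hx

theorem exists_mem_gaussGE_degree_lt (hL : IsPureOperator lam L) (he : operatorEval Φ e L = 0)
    {P : ConvLaurent[X]} (hP : P ∈ gaussGE lam c) :
    ∃ R ∈ gaussGE lam c, R.degree < L.degree ∧ operatorEval Φ e R = operatorEval Φ e P := by
  have hstep : ∀ P ∈ gaussGE lam c, ∀ i,
      skewMul (qShift q) (.monomial i (P.coeff (i + L.natDegree))) L ∈ gaussGE lam c := by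
    intro P hP i
    have hT : .monomial i (P.coeff (i + L.natDegree)) ∈ gaussGE lam (c - lam * L.natDegree) :=
      monomial_mem_gaussGE (orderGE_antitone (by push_cast; linarith) (hP (i + L.natDegree)))
    simpa using skewMul_mem_gaussGE (q := q) hT hL.mem_gaussGE
  obtain ⟨Q, R, hR, hdeg, rfl⟩ := exists_eq_skewMul_add hL.monic hstep hP
  refine ⟨R, hR, hdeg, ?_⟩
  rw [map_add, operatorEval_skewMul, he, operatorEval_zero, zero_add]

theorem eq_zero_of_forall_mem_gaussLattice (hL : IsPureOperator lam L)
    (he : IsMinimalOperator Φ e L) {δ : ℚ} (hδ : 0 < δ)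
    (hx : ∀ s : ℕ, x ∈ gaussLattice Φ e lam (c + s * δ)) : x = 0 := by
  have hred (s : ℕ) : ∃ R ∈ gaussGE lam (c + s * δ), R.degree < L.degree ∧
      operatorEval Φ e R = x := by
    obtain ⟨P, hP, rfl⟩ := hx s
    exact hL.exists_mem_gaussGE_degree_lt he.operatorEval_eq_zero hP
  obtain ⟨R, -, hdeg, rfl⟩ := hred 0
  suffices R = 0 by rw [this, map_zero]
  refine eq_zero_of_forall_mem_gaussGE (lam := lam) (c := c) hδ fun s => ?_
  obtain ⟨R', hR', hdeg', heq⟩ := hred s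
  have hsub : R - R' = 0 := he.eq_zero_of_degree_lt _
    ((Polynomial.degree_sub_le _ _).trans_lt (max_lt hdeg hdeg')) (by rw [map_sub, heq, sub_self])
  rwa [sub_eq_zero.1 hsub]

end IsPureOperator

/-- On a module pure of slope `lam`, the constant term of an operator pure of a smaller slope
dominates all its other terms, and the leading term dominates if the slope is larger. -/
theorem exists_pos_forall_mem_gaussLattice (hL : IsPureOperator lam L)
    (he : operatorEval Φ e L = 0) (hΦ : Function.Injective Φ) {lam' : ℚ} {L' : ConvLaurent[X]}
    (hL' : IsPureOperator lam' L') (hne : lam' ≠ lam) (hx : operatorEval Φ x L' = 0) :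
    ∃ δ : ℚ, 0 < δ ∧ ∀ c, x ∈ gaussLattice Φ e lam c → x ∈ gaussLattice Φ e lam (c + δ) := by
  rcases hne.lt_or_gt with hlt | hlt
  · refine ⟨lam - lam', sub_pos.2 hlt, fun c hc => ?_⟩
    have hb : L'.coeff 0 • x ∈ gaussLattice Φ e lam (lam' * L'.natDegree + (lam - lam') + c) := by
      have h := operatorEval_mem_gaussLattice (hL'.sub_monomial_zero_mem_gaussGE hlt.le) hc
      rw [map_sub, hx, zero_sub, operatorEval_monomial, Function.iterate_zero_apply] at h
      exact neg_mem_iff.1 h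
    have hinv : .monomial 0 (L'.coeff 0)⁻¹ ∈ gaussGE lam (-(lam' * L'.natDegree)) :=
      monomial_mem_gaussGE (by
        simpa [hL'.ord_coeff_zero] using inv_mem_orderGE hL'.coeff_zero_ne_zero)
    have h := operatorEval_mem_gaussLattice hinv hb
    rw [operatorEval_monomial, Function.iterate_zero_apply,
      inv_smul_smul₀ hL'.coeff_zero_ne_zero] at h
    exact gaussLattice_antitone (by linarith) h
  · refine ⟨lam' - lam, sub_pos.2 hlt, fun c hc =>
      hL.mem_gaussLattice_of_iterate_mem hΦ he (n := L'.natDegree) ?_⟩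
    have h := operatorEval_mem_gaussLattice (hL'.sub_X_pow_mem_gaussGE hlt.le) hc
    rw [map_sub, hx, zero_sub, ← Polynomial.monomial_one_right_eq_X_pow, operatorEval_monomial,
      one_smul] at h
    exact gaussLattice_antitone (by linarith) (neg_mem_iff.1 h)

theorem eq_zero_of_operatorEval_eq_zero (hL : IsPureOperator lam L)
    (he : IsMinimalOperator Φ e L) (hΦ : Function.Injective Φ)
    (hxe : x ∈ LinearMap.range (operatorEval Φ e)) {lam' : ℚ} {L' : ConvLaurent[X]}
    (hL' : IsPureOperator lam' L') (hne : lam' ≠ lam) (hx : operatorEval Φ x L' = 0) : x = 0 := by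
  obtain ⟨δ, hδ, hstep⟩ :=
    exists_pos_forall_mem_gaussLattice hL he.operatorEval_eq_zero hΦ hL' hne hx
  obtain ⟨c, hc⟩ := exists_mem_gaussLattice lam hxe
  refine hL.eq_zero_of_forall_mem_gaussLattice he hδ (c := c) fun s => ?_
  induction s with
  | zero => simpa using hc
  | succ s ih => exact gaussLattice_antitone (le_of_eq (by push_cast; ring)) (hstep _ ih)

end GaussLattices

section Factorization

theorem sum_antidiagonal_not_lt_eq {R : Type*} [Semiring R] (σ : R →+* R) (g : ℕ → R) {b : ℕ → R}
    {k : ℕ} (hb : ∀ j, k ≤ j → b j = if j = k then 1 else 0) (n : ℕ) :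
    ∑ x ∈ Finset.HasAntidiagonal.antidiagonal n with ¬ x.2 < k,
      g (x.1 + k) * (σ ^ x.1) (b x.2) = if n < k then 0 else g n := by
  have hterm : ∀ x ∈ (Finset.HasAntidiagonal.antidiagonal n).filter fun x => ¬ x.2 < k,
      g (x.1 + k) * (σ ^ x.1) (b x.2) = if x = (n - k, k) then g n else 0 := by
    rintro ⟨i, j⟩ hx
    obtain ⟨rfl, hj⟩ : i + j = n ∧ k ≤ j := by simpa using hx
    rw [hb j hj]
    by_cases h : j = k <;> simp [h]
  rw [Finset.sum_congr rfl hterm, Finset.sum_ite_eq']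
  rcases lt_or_ge n k with h | h
  · have hne : n - k + k ≠ n := by omega
    simp [h, hne]
  · simp [h.not_gt, Nat.sub_add_cancel h]

theorem exists_skewMul_coeff_eq {K : Type*} [Field K] (σ : K →+* K) {g : ℕ → K} {k m : ℕ}
    (hg : ∀ n, m < n → g n = 0) :
    ∃ A B : K[X], A.coeff 0 = 1 + g k ∧ (∀ i, 0 < i → A.coeff i = g (i + k)) ∧ B.Monic ∧
      B.natDegree = k ∧ (∀ j < k, B.coeff j = g j) ∧
      ∀ n, (skewMul σ A B).coeff n = (if n = k then 1 else 0) + (g n +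
        ∑ x ∈ Finset.HasAntidiagonal.antidiagonal n with x.2 < k,
          g (x.1 + k) * (σ ^ x.1) (g x.2)) := by
  let P : K[X] := (PowerSeries.mk fun i => g (i + k)).trunc (m + 1)
  let R : K[X] := (PowerSeries.mk g).trunc k
  have hP (i : ℕ) : P.coeff i = g (i + k) := by
    simp only [P, PowerSeries.coeff_trunc, PowerSeries.coeff_mk]
    split_ifs with h
    exacts [rfl, (hg _ (by omega)).symm]
  have hR (j : ℕ) : R.coeff j = if j < k then g j else 0 := by
    simp only [R, PowerSeries.coeff_trunc, PowerSeries.coeff_mk]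
  have hdeg : R.degree < k := PowerSeries.degree_trunc_lt _ _
  refine ⟨1 + P, .X ^ k + R, by simp [hP], fun i hi => by simp [hP, Polynomial.coeff_one, hi.ne'],
    Polynomial.monic_X_pow_add hdeg, ?_,
    fun j hj => by simp [hR, hj, Polynomial.coeff_X_pow, hj.ne], fun n => ?_⟩
  · exact (Polynomial.natDegree_add_eq_left_of_degree_lt (by simpa using hdeg)).trans
      (Polynomial.natDegree_X_pow k)
  have hXR (j : ℕ) : (.X ^ k + R : K[X]).coeff j =
      (if j = k then 1 else 0) + if j < k then g j else 0 := by
    rw [Polynomial.coeff_add, Polynomial.coeff_X_pow, hR]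
  have hlow : ∑ x ∈ Finset.HasAntidiagonal.antidiagonal n with x.2 < k,
      g (x.1 + k) * (σ ^ x.1) ((.X ^ k + R : K[X]).coeff x.2) =
      ∑ x ∈ Finset.HasAntidiagonal.antidiagonal n with x.2 < k,
        g (x.1 + k) * (σ ^ x.1) (g x.2) :=
    Finset.sum_congr rfl fun x hx => by
      have hx' := (Finset.mem_filter.1 hx).2
      rw [hXR, if_neg hx'.ne, if_pos hx', zero_add]
  have hhigh : ∑ x ∈ Finset.HasAntidiagonal.antidiagonal n with ¬ x.2 < k,
      g (x.1 + k) * (σ ^ x.1) ((.X ^ k + R : K[X]).coeff x.2) = if n < k then 0 else g n :=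
    sum_antidiagonal_not_lt_eq σ g (fun j hj => by rw [hXR, if_neg hj.not_gt, add_zero]) n
  rw [skewMul, map_add, operatorEval_one, ← skewMul, Polynomial.coeff_add, hXR, coeff_skewMul,
    ← Finset.sum_filter_add_sum_filter_not _ (fun x => x.2 < k)]
  simp only [hP, hlow, hhigh]
  split_ifs <;> ring

/-- The lower bound for the order of the coefficient of `Φ ^ n` under which the factorization
equation is solved: it is `lam * (k - n)`, increased from `n = k` on so that the quadratic part has
order larger by `δ`. -/
def factorWeight (lam δ : ℚ) (k n : ℕ) : ℚ :=
  lam * (k - n) + δ * ((n + 1 - k : ℕ) : ℚ)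

theorem factorWeight_add_le {lam δ : ℚ} (hδ : 0 ≤ δ) {i j k : ℕ} (hj : j < k) :
    factorWeight lam δ k (i + j) + δ ≤ factorWeight lam δ k (i + k) + factorWeight lam δ k j := by
  have hle : ((i + j + 1 - k : ℕ) : ℚ) ≤ i := by exact_mod_cast (by omega : i + j + 1 - k ≤ i)
  rw [factorWeight, factorWeight, factorWeight, show i + k + 1 - k = i + 1 by omega,
    show j + 1 - k = 0 by omega]
  push_cast
  linarith [mul_le_mul_of_nonneg_left hle hδ]

variable {q : ℂˣ} {lam δ : ℚ} {k : ℕ}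

theorem exists_pos_forall_mem_orderGE_factorWeight (hδ : 0 < δ) {E : ConvLaurent[X]}
    (hE : E ∈ gaussGE lam (lam * k))
    (hE' : ∀ n, k ≤ n → (E.coeff n : LaurentSeries ℂ) ∈ orderGE (lam * (k - n) + δ)) :
    ∃ η > 0, ∀ n, (E.coeff n : LaurentSeries ℂ) ∈ orderGE (factorWeight lam η k n) := by
  have hm : (0 : ℚ) < E.natDegree + 1 := by positivity
  refine ⟨δ / (E.natDegree + 1), div_pos hδ hm, fun n => ?_⟩
  rcases lt_or_ge n k with hn | hn
  · rw [factorWeight, show n + 1 - k = 0 by omega, Nat.cast_zero, mul_zero, add_zero, mul_sub]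
    exact hE n
  rcases lt_or_ge E.natDegree n with hnm | hnm
  · simp [Polynomial.coeff_eq_zero_of_natDegree_lt hnm, zero_mem]
  · refine orderGE_antitone (add_le_add_right ?_ _) (hE' n hn)
    have hle : ((n + 1 - k : ℕ) : ℚ) ≤ E.natDegree + 1 := by
      exact_mod_cast (by omega : n + 1 - k ≤ E.natDegree + 1)
    exact (mul_le_mul_of_nonneg_left hle (div_pos hδ hm).le).trans_eq (div_mul_cancel₀ _ hm.ne')

theorem exists_add_sum_qShift_eq (hq : ‖(q : ℂ)‖ ≤ 1) (hδ : 0 < δ) {E : ConvLaurent[X]}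
    (hE : ∀ n, (E.coeff n : LaurentSeries ℂ) ∈ orderGE (factorWeight lam δ k n)) :
    ∃ g : ℕ → ConvLaurent, (∀ n, E.natDegree < n → g n = 0) ∧
      (∀ n, (g n : LaurentSeries ℂ) ∈ orderGE (factorWeight lam δ k n)) ∧
      ∀ n, g n + ∑ x ∈ Finset.HasAntidiagonal.antidiagonal n with x.2 < k,
        g (x.1 + k) * ((qShift q : ConvLaurent →+* ConvLaurent) ^ x.1) (g x.2) = E.coeff n := by
  have hzero (n : ℕ) (hn : E.natDegree < n) : (E.coeff n : LaurentSeries ℂ) = 0 := by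
    rw [Polynomial.coeff_eq_zero_of_natDegree_lt hn, ZeroMemClass.coe_zero]
  obtain ⟨γ, hγ0, hγord, hγconv, hγeq⟩ := exists_add_quadraticPart_eq hq hδ
    (fun i j hj => factorWeight_add_le hδ.le hj) hzero hE fun n => (E.coeff n).2
  refine ⟨fun n => ⟨γ n, hγconv n⟩, fun n hn => Subtype.ext (hγ0 n hn), hγord, fun n => ?_⟩
  refine Subtype.ext ((Eq.trans ?_ (hγeq n)))
  simp only [quadraticPart, AddMemClass.coe_add, AddSubmonoidClass.coe_finsetSum,
    MulMemClass.coe_mul, coe_qShift_pow]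

/-- Hensel's lemma for difference operators. -/
theorem exists_skewMul_eq_X_pow_add (hq : ‖(q : ℂ)‖ ≤ 1) (hδ : 0 < δ) {E : ConvLaurent[X]}
    (hE : E ∈ gaussGE lam (lam * k))
    (hE' : ∀ n, k ≤ n → (E.coeff n : LaurentSeries ℂ) ∈ orderGE (lam * (k - n) + δ)) :
    ∃ A B : ConvLaurent[X], ∃ η > 0, skewMul (qShift q) A B = .X ^ k + E ∧
      A - 1 ∈ gaussGE lam η ∧ B.Monic ∧ B.natDegree = k ∧ B ∈ gaussGE lam (lam * k) := by
  obtain ⟨η, hη, hEη⟩ := exists_pos_forall_mem_orderGE_factorWeight hδ hE hE'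
  obtain ⟨g, hg0, hg, hgE⟩ := exists_add_sum_qShift_eq hq hη hEη
  obtain ⟨A, B, hA0, hA, hB, rfl, hBg, hAB⟩ :=
    exists_skewMul_coeff_eq (qShift q : ConvLaurent →+* ConvLaurent) (k := k) hg0
  refine ⟨A, B, η, hη, ?_, fun i => ?_, hB, rfl, fun j => ?_⟩
  · ext1 n
    rw [hAB, hgE, Polynomial.coeff_add, Polynomial.coeff_X_pow]
  · have hAi : (A - 1).coeff i = g (i + B.natDegree) := by
      rcases i.eq_zero_or_pos with rfl | hi
      · simp [hA0]
      · simp [hA i hi, Polynomial.coeff_one, hi.ne']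
    rw [hAi]
    refine orderGE_antitone ?_ (hg _)
    rw [factorWeight, show i + B.natDegree + 1 - B.natDegree = i + 1 by omega]
    push_cast
    linarith [mul_nonneg hη.le i.cast_nonneg]
  · rcases lt_trichotomy j B.natDegree with hj | rfl | hj
    · rw [hBg j hj]
      refine orderGE_antitone (le_of_eq ?_) (hg j)
      rw [factorWeight, show j + 1 - B.natDegree = 0 by omega]
      push_cast
      ring
    · rw [sub_self, hB.coeff_natDegree, mem_orderGE_iff_order (by simp)]
      simp
    · simp [Polynomial.coeff_eq_zero_of_natDegree_lt hj, zero_mem]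

/-- All edges of the Newton polygon of `L` have slope (with the sign convention of `newtonSlopes`)
less than `b`; this is meant for `L.coeff 0 ≠ 0`. -/
def SlopesLT (L : ConvLaurent[X]) (b : ℚ) : Prop :=
  ∀ i ∈ L.support, 0 < i → (ord (L.coeff 0) : ℚ) < ord (L.coeff i) + b * i

theorem ord_mul {f g : ConvLaurent} (hf : f ≠ 0) (hg : g ≠ 0) : ord (f * g) = ord f + ord g :=
  HahnSeries.order_mul (by simpa using hf) (by simpa using hg)

theorem ord_eq_zero_of_sub_one_mem_orderGE (hδ : 0 < δ) {f : ConvLaurent}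
    (hf : ((f - 1 : ConvLaurent) : LaurentSeries ℂ) ∈ orderGE δ) : f ≠ 0 ∧ ord f = 0 := by
  have hcoeff : (f : LaurentSeries ℂ).coeff 0 = 1 := by
    simpa [sub_eq_zero] using hf 0 (by simpa using hδ)
  have hne : (f : LaurentSeries ℂ) ≠ 0 := fun h => by simp [h] at hcoeff
  have hmem : (f : LaurentSeries ℂ) ∈ orderGE 0 := by
    have hone : (1 : LaurentSeries ℂ) ∈ orderGE 0 := by
      simp [mem_orderGE_iff_order one_ne_zero]
    simpa using add_mem (orderGE_antitone hδ.le hf) hone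
  refine ⟨by simpa using hne,
    le_antisymm (HahnSeries.order_le_of_coeff_ne_zero (by simp [hcoeff])) ?_⟩
  exact_mod_cast (mem_orderGE_iff_order hne).1 hmem

theorem ord_coeff_zero_smul_of_sub_one_mem_gaussGE (hδ : 0 < δ) {a : ConvLaurent} (ha : a ≠ 0)
    {A : ConvLaurent[X]} (hA : A - 1 ∈ gaussGE lam δ) :
    ord ((a • A).coeff 0) = ord a ∧ SlopesLT (a • A) lam := by
  have hA0 := ord_eq_zero_of_sub_one_mem_orderGE (f := A.coeff 0) hδ (by simpa using hA 0)
  have h0 : ord ((a • A).coeff 0) = ord a := by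
    rw [Polynomial.coeff_smul, smul_eq_mul, ord_mul ha hA0.1, hA0.2, add_zero]
  refine ⟨h0, fun i hi hi0 => ?_⟩
  rw [Polynomial.mem_support_iff, Polynomial.coeff_smul, smul_eq_mul, mul_ne_zero_iff] at hi
  have hle : δ ≤ ord (A.coeff i) + lam * i := by
    have hAi := mem_gaussGE_iff.1 hA i
    rw [Polynomial.mem_support_iff, Polynomial.coeff_sub, Polynomial.coeff_one,
      if_neg hi0.ne', sub_zero] at hAi
    exact hAi hi.2
  rw [h0, Polynomial.coeff_smul, smul_eq_mul, ord_mul ha hi.2]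
  push_cast
  linarith

theorem exists_pos_forall_add_le {ι : Type*} (S : Finset ι) {c : ℚ} {f : ι → ℚ}
    (h : ∀ i ∈ S, c < f i) : ∃ δ > 0, ∀ i ∈ S, c + δ ≤ f i := by
  have hev : ∀ᶠ δ : ℚ in 𝓝[>] 0, ∀ i ∈ S, c + δ ≤ f i := by
    refine (Finset.eventually_all _).2 fun i hi => ?_
    filter_upwards [Ioo_mem_nhdsGT (sub_pos.2 (h i hi))] with δ hδ
    linarith [hδ.2]
  obtain ⟨δ, hle, hδ⟩ := (hev.and self_mem_nhdsWithin).exists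
  exact ⟨δ, hδ, hle⟩

theorem inv_smul_sub_X_pow_mem_gaussGE {L : ConvLaurent[X]} (hk : L.coeff k ≠ 0)
    (hord : (ord (L.coeff k) : ℚ) + lam * k = ord (L.coeff 0))
    (hle : ∀ i ∈ L.support, (ord (L.coeff 0) : ℚ) ≤ ord (L.coeff i) + lam * i) :
    (L.coeff k)⁻¹ • L - .X ^ k ∈ gaussGE lam (lam * k) := by
  refine sub_mem (gaussGE_antitone (by linarith) (smul_mem_gaussGE (inv_mem_orderGE hk)
    (mem_gaussGE_iff.2 hle))) ?_
  rw [← Polynomial.monomial_one_right_eq_X_pow]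
  refine monomial_mem_gaussGE ?_
  rw [sub_self, mem_orderGE_iff_order (by simp)]
  simp

theorem coeff_inv_smul_sub_X_pow_mem_orderGE {L : ConvLaurent[X]} (hk : L.coeff k ≠ 0)
    (hord : (ord (L.coeff k) : ℚ) + lam * k = ord (L.coeff 0))
    (hgap : ∀ i ∈ L.support, k < i → (ord (L.coeff 0) : ℚ) + δ ≤ ord (L.coeff i) + lam * i)
    (n : ℕ) (hn : k ≤ n) :
    (((L.coeff k)⁻¹ • L - .X ^ k).coeff n : LaurentSeries ℂ) ∈ orderGE (lam * (k - n) + δ) := by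
  rcases hn.eq_or_lt with rfl | hkn
  · simp [hk, zero_mem]
  have hcoeff : ((L.coeff k)⁻¹ • L - .X ^ k).coeff n = (L.coeff k)⁻¹ * L.coeff n := by
    simp [Polynomial.coeff_X_pow, hkn.ne']
  have hLn : (L.coeff n : LaurentSeries ℂ) ∈ orderGE (ord (L.coeff 0) + δ - lam * n) := by
    by_cases hLn : L.coeff n = 0
    · simp [hLn, zero_mem]
    · rw [mem_orderGE_iff_order (by simpa using hLn)]
      exact sub_le_iff_le_add.2 (hgap n (Polynomial.mem_support_iff.2 hLn) hkn)
  rw [hcoeff, MulMemClass.coe_mul]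
  exact orderGE_antitone (by linarith) (mul_mem_orderGE (inv_mem_orderGE hk) hLn)

theorem exists_skewMul_of_edge (hq : ‖(q : ℂ)‖ ≤ 1) {L : ConvLaurent[X]} (h0 : L.coeff 0 ≠ 0)
    (hk : k ∈ L.support) (hk0 : 0 < k)
    (hord : (ord (L.coeff k) : ℚ) + lam * k = ord (L.coeff 0))
    (hle : ∀ i ∈ L.support, (ord (L.coeff 0) : ℚ) ≤ ord (L.coeff i) + lam * i)
    (hlt : ∀ i ∈ L.support, k < i → (ord (L.coeff 0) : ℚ) < ord (L.coeff i) + lam * i) :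
    ∃ A B, L = skewMul (qShift q) A B ∧ SlopesLT A lam ∧ IsPureOperator lam B := by
  rw [Polynomial.mem_support_iff] at hk
  obtain ⟨δ, hδ, hgap⟩ : ∃ δ > 0, ∀ i ∈ L.support, k < i →
      (ord (L.coeff 0) : ℚ) + δ ≤ ord (L.coeff i) + lam * i := by
    obtain ⟨δ, hδ, hle⟩ := exists_pos_forall_add_le {i ∈ L.support | k < i} fun i hi =>
      hlt i (Finset.mem_filter.1 hi).1 (Finset.mem_filter.1 hi).2
    exact ⟨δ, hδ, fun i hi hki => hle i (Finset.mem_filter.2 ⟨hi, hki⟩)⟩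
  obtain ⟨A, B, η, hη, hAB, hA, hB, rfl, hBlam⟩ := exists_skewMul_eq_X_pow_add hq hδ
    (inv_smul_sub_X_pow_mem_gaussGE hk hord hle)
    (coeff_inv_smul_sub_X_pow_mem_orderGE hk hord hgap)
  obtain ⟨hA0, hAlt⟩ := ord_coeff_zero_smul_of_sub_one_mem_gaussGE hη hk hA
  have hL : L = skewMul (qShift q) (L.coeff B.natDegree • A) B := by
    rw [skewMul, map_smul, ← skewMul, hAB, add_sub_cancel, smul_inv_smul₀ hk]
  have hL0 : L.coeff 0 = (L.coeff B.natDegree • A).coeff 0 * B.coeff 0 := by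
    conv_lhs => rw [hL, coeff_skewMul]
    simp
  have hne := mul_ne_zero_iff.1 (hL0 ▸ h0)
  refine ⟨_, B, hL, hAlt, hB, hk0, hne.2, ?_, hBlam⟩
  rw [hL0, ord_mul hne.1 hne.2, hA0] at hord
  push_cast at hord
  linarith

theorem exists_eq_skewMul_isPureOperator (hq : ‖(q : ℂ)‖ ≤ 1) {L : ConvLaurent[X]}
    (hL : 0 < L.natDegree) (h0 : L.coeff 0 ≠ 0) :
    ∃ lam A B, L = skewMul (qShift q) A B ∧ SlopesLT A lam ∧ IsPureOperator lam B ∧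
      ∀ b, SlopesLT L b → lam < b := by
  obtain ⟨lam, k, hkS, hk0, hord, hle, hlt⟩ := exists_edge_of_exists_lt (S := L.support)
    (fun i => (ord (L.coeff i) : ℚ))
    ⟨_, Polynomial.natDegree_mem_support_of_nonzero (Polynomial.ne_zero_of_natDegree_gt hL), hL⟩
  simp only [Nat.cast_zero, mul_zero, add_zero] at hord hle hlt
  have hle' (i : ℕ) (hi : i ∈ L.support) : (ord (L.coeff 0) : ℚ) ≤ ord (L.coeff i) + lam * i := by
    rcases i.eq_zero_or_pos with rfl | hi0
    exacts [by simp, hle i hi hi0]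
  obtain ⟨A, B, hAB, hA, hB⟩ := exists_skewMul_of_edge hq h0 hkS hk0 hord hle' hlt
  refine ⟨lam, A, B, hAB, hA, hB, fun b hb => ?_⟩
  have := hb k hkS hk0
  exact lt_of_mul_lt_mul_right (a := (k : ℚ)) (by linarith) k.cast_nonneg

end Factorization

section PureSubquotients

theorem exists_monic_coeff_eq {R : Type*} [Semiring R] [Nontrivial R] {m : ℕ} {a : Fin (m + 1) → R}
    (ha : a (Fin.last m) = 1) :
    ∃ L : R[X], L.Monic ∧ L.natDegree = m ∧ ∀ i : Fin (m + 1), L.coeff i = a i := by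
  classical
  have hcoeff (i : Fin (m + 1)) : (Polynomial.ofFn (m + 1) a).coeff i = a i :=
    Polynomial.ofFn_coeff_eq_val_of_lt a i.2
  have hm : (Polynomial.ofFn (m + 1) a).coeff m = 1 := (hcoeff (Fin.last m)).trans ha
  have hle := Nat.le_of_lt_succ (Polynomial.ofFn_natDegree_lt (by omega) a)
  exact ⟨_, Polynomial.monic_of_natDegree_le_of_coeff_eq_one m hle hm,
    Polynomial.natDegree_eq_of_le_of_coeff_ne_zero hle (by simp [hm]), hcoeff⟩

variable {q : ℂˣ} {M : Type*} [AddCommGroup M] [Module ConvLaurent M]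
  {Φ : M →ₛₗ[(qShift q : ConvLaurent →+* ConvLaurent)] M} {lam : ℚ}

theorem isPure_iff :
    IsPure Φ lam ↔ ∃ e L, IsMinimalOperator Φ e L ∧ LinearMap.range (operatorEval Φ e) = ⊤ ∧
      IsPureOperator lam L := by
  have hsum (e : M) (L : ConvLaurent[X]) :
      ∑ i : Fin (L.natDegree + 1), L.coeff i • Φ^[i] e = operatorEval Φ e L :=
    Polynomial.sum_fin (fun i a => a • Φ^[i] e) (fun i => zero_smul _ _)
      (Polynomial.degree_le_natDegree.trans_lt (by exact_mod_cast L.natDegree.lt_succ_self))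
  constructor
  · rintro ⟨m, a, ⟨hlast, h0, e, hli, hspan, hrel⟩, ha⟩
    obtain ⟨L, hL, rfl, hLa⟩ := exists_monic_coeff_eq hlast
    obtain rfl : (fun i : Fin (L.natDegree + 1) => L.coeff i) = a := funext hLa
    have he := (isMinimalOperator_iff hL).2 ⟨hli, (hsum e L).symm.trans hrel⟩
    exact ⟨e, L, he, he.span_iterate_eq_range.symm.trans hspan,
      isPureOperator_of_newtonSlopes_eq hL h0 ha⟩
  · rintro ⟨e, L, he, htop, hL⟩
    have hli := ((isMinimalOperator_iff hL.monic).1 he).1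
    exact ⟨L.natDegree, fun i => L.coeff i, ⟨hL.monic.coeff_natDegree, hL.coeff_zero_ne_zero, e,
      hli, he.span_iterate_eq_range.trans htop, (hsum e L).trans he.operatorEval_eq_zero⟩,
      hL.newtonSlopes_eq⟩

theorem IsStable.range_operatorEval_le {N : Submodule ConvLaurent M} (hN : IsStable Φ N) {x : M}
    (hx : x ∈ N) : LinearMap.range (operatorEval Φ x) ≤ N := by
  rintro _ ⟨P, rfl⟩
  rw [operatorEval_apply]
  exact sum_mem fun i _ => N.smul_mem _
    ((show Set.MapsTo Φ N N from fun y => (hN y).2).iterate i hx)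

variable {N₁ N₂ : Submodule ConvLaurent M} {h₁ : IsStable Φ N₁} {h₂ : IsStable Φ N₂}

theorem mk_submoduleOf_eq_zero_iff {x : N₂} :
    (Submodule.Quotient.mk x : N₂ ⧸ N₁.submoduleOf N₂) = 0 ↔ (x : M) ∈ N₁ :=
  Submodule.Quotient.mk_eq_zero _

theorem subquotient_injective : Function.Injective (subquotient Φ N₁ N₂ h₁ h₂) := by
  rw [injective_iff_map_eq_zero, (Submodule.Quotient.mk_surjective _).forall]
  exact fun x hx => mk_submoduleOf_eq_zero_iff.2 ((h₁ _).1 (mk_submoduleOf_eq_zero_iff.1 hx))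

theorem operatorEval_subquotient_mk (x : N₂) (P : ConvLaurent[X]) :
    operatorEval (subquotient Φ N₁ N₂ h₁ h₂) (Submodule.Quotient.mk x) P =
      Submodule.Quotient.mk ⟨operatorEval Φ x P, h₂.range_operatorEval_le x.2 ⟨P, rfl⟩⟩ := by
  have hcoe : operatorEval (Φ.restrict fun y hy => (h₂ y).2 hy) x P =
      (⟨operatorEval Φ x P, h₂.range_operatorEval_le x.2 ⟨P, rfl⟩⟩ : N₂) :=
    Subtype.ext (map_operatorEval (Ψ := Φ) (g := N₂.subtype) (fun _ => rfl) x P)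
  rw [← hcoe]
  exact (map_operatorEval (Φ := Φ.restrict fun y hy => (h₂ y).2 hy)
    (Ψ := subquotient Φ N₁ N₂ h₁ h₂) (g := (N₁.submoduleOf N₂).mkQ) (fun _ => rfl) x P).symm

theorem operatorEval_subquotient_mk_eq_zero_iff {x : N₂} {P : ConvLaurent[X]} :
    operatorEval (subquotient Φ N₁ N₂ h₁ h₂) (Submodule.Quotient.mk x) P = 0 ↔
      operatorEval Φ x P ∈ N₁ := by
  rw [operatorEval_subquotient_mk, mk_submoduleOf_eq_zero_iff]

theorem isPure_subquotient_range {e : M} {B : ConvLaurent[X]}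
    {he : IsStable Φ (LinearMap.range (operatorEval Φ e))} (hB : IsPureOperator lam B)
    (hBe : operatorEval Φ e B ∈ N₁)
    (hmin : ∀ P : ConvLaurent[X], P.degree < B.degree → operatorEval Φ e P ∈ N₁ → P = 0) :
    IsPure (subquotient Φ N₁ _ h₁ he) lam := by
  have hmem : e ∈ LinearMap.range (operatorEval Φ e) := ⟨1, operatorEval_one e⟩
  refine isPure_iff.2 ⟨Submodule.Quotient.mk ⟨e, hmem⟩, B, ⟨hB.monic,
    operatorEval_subquotient_mk_eq_zero_iff.2 hBe, fun P hP hPe =>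
      hmin P hP (operatorEval_subquotient_mk_eq_zero_iff.1 hPe)⟩, ?_, hB⟩
  rw [eq_top_iff]
  rintro y -
  obtain ⟨⟨_, P, rfl⟩, rfl⟩ := Submodule.Quotient.mk_surjective _ y
  exact ⟨P, operatorEval_subquotient_mk _ P⟩

theorem IsPure.exists_generator (h : IsPure (subquotient Φ N₁ N₂ h₁ h₂) lam) :
    ∃ e ∈ N₂, ∃ L, IsPureOperator lam L ∧ operatorEval Φ e L ∈ N₁ ∧
      N₂ ≤ N₁ ⊔ LinearMap.range (operatorEval Φ e) := by
  obtain ⟨e, L, he, htop, hL⟩ := isPure_iff.1 h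
  obtain ⟨e, rfl⟩ := Submodule.Quotient.mk_surjective _ e
  refine ⟨e, e.2, L, hL, operatorEval_subquotient_mk_eq_zero_iff.1 he.operatorEval_eq_zero,
    fun x hx => ?_⟩
  obtain ⟨P, hP⟩ := LinearMap.range_eq_top.1 htop (Submodule.Quotient.mk ⟨x, hx⟩)
  rw [operatorEval_subquotient_mk, eq_comm, Submodule.Quotient.eq] at hP
  have hxP : x - operatorEval Φ e P ∈ N₁ := hP
  rw [← sub_add_cancel x (operatorEval Φ e P)]
  exact Submodule.add_mem_sup hxP ⟨P, rfl⟩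

/-- A morphism between pure subquotients of different slopes vanishes. -/
theorem IsPure.le_of_slope_ne {P₁ P₂ : Submodule ConvLaurent M} {hP₁ : IsStable Φ P₁}
    {hP₂ : IsStable Φ P₂} {mu : ℚ} (hP : IsPure (subquotient Φ P₁ P₂ hP₁ hP₂) mu)
    (hN : IsPure (subquotient Φ N₁ N₂ h₁ h₂) lam) (hne : mu ≠ lam) (hle₁ : P₁ ≤ N₁)
    (hle₂ : P₂ ≤ N₂) : P₂ ≤ N₁ := by
  obtain ⟨x, hx, L', hL', hxL', hspan⟩ := hP.exists_generator
  obtain ⟨e, L, he, htop, hL⟩ := isPure_iff.1 hN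
  have hzero : (Submodule.Quotient.mk ⟨x, hle₂ hx⟩ : N₂ ⧸ N₁.submoduleOf N₂) = 0 :=
    eq_zero_of_operatorEval_eq_zero hL he subquotient_injective (htop ▸ Submodule.mem_top) hL' hne
      (operatorEval_subquotient_mk_eq_zero_iff.2 (hle₁ hxL'))
  have hxN : x ∈ N₁ := mk_submoduleOf_eq_zero_iff.1 hzero
  exact hspan.trans (sup_le hle₁ (h₁.range_operatorEval_le hxN))

end PureSubquotients

section Existence

theorem strictMono_snoc {α : Type*} [Preorder α] {r : ℕ} {f : Fin r → α} {x : α}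
    (hf : StrictMono f) (hx : ∀ i, f i < x) :
    StrictMono (Fin.snoc f x : Fin (r + 1) → α) := by
  intro i j hij
  induction j using Fin.lastCases with
  | last =>
    induction i using Fin.lastCases with
    | last => exact absurd hij (lt_irrefl _)
    | cast i => simpa using hx i
  | cast j =>
    induction i using Fin.lastCases with
    | last => exact absurd hij (not_lt.2 (Fin.le_last _))
    | cast i => simpa using hf (Fin.castSucc_lt_castSucc_iff.1 hij)

variable {q : ℂˣ} {M : Type*} [AddCommGroup M] [Module ConvLaurent M]
  {Φ : M →ₛₗ[(qShift q : ConvLaurent →+* ConvLaurent)] M}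
  {N N' N₁ N₂ N₁' N₂' : Submodule ConvLaurent M} {lam b : ℚ}

theorem IsPure.congr_subquotient {h₁ : IsStable Φ N₁} {h₂ : IsStable Φ N₂}
    (h : IsPure (subquotient Φ N₁ N₂ h₁ h₂) lam) (e₁ : N₁' = N₁) (e₂ : N₂' = N₂)
    (h₁' : IsStable Φ N₁') (h₂' : IsStable Φ N₂') :
    IsPure (subquotient Φ N₁' N₂' h₁' h₂') lam := by
  subst e₁ e₂
  exact h

/-- `N` has a tower of difference submodules with pure quotients of increasing slopes, all of them
smaller than `b`. -/
def HasFiltrationBelow (Φ : M →ₛₗ[(qShift q : ConvLaurent →+* ConvLaurent)] M)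
    (N : Submodule ConvLaurent M) (b : ℚ) : Prop :=
  ∃ (r : ℕ) (F : Fin (r + 1) → Submodule ConvLaurent M) (lam : Fin r → ℚ)
    (st : ∀ i, IsStable Φ (F i)), F 0 = ⊥ ∧ F (Fin.last r) = N ∧ StrictMono F ∧
    (∀ i : Fin r, IsPure
      (subquotient Φ (F i.castSucc) (F i.succ) (st i.castSucc) (st i.succ)) (lam i)) ∧
    StrictMono lam ∧ ∀ i, lam i < b

theorem isStable_bot (hΦ : Function.Injective Φ) : IsStable Φ ⊥ := fun x => by
  rw [Submodule.mem_bot, Submodule.mem_bot, map_eq_zero_iff Φ hΦ]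

theorem hasFiltrationBelow_bot (hΦ : Function.Injective Φ) (b : ℚ) :
    HasFiltrationBelow Φ ⊥ b :=
  ⟨0, fun _ => ⊥, Fin.elim0, fun _ => isStable_bot hΦ, rfl, rfl,
    Fin.strictMono_iff_lt_succ.2 fun i => i.elim0, fun i => i.elim0, fun i => i.elim0,
    fun i => i.elim0⟩

theorem HasFiltrationBelow.snoc (h : HasFiltrationBelow Φ N' lam) {hN' : IsStable Φ N'}
    {hN : IsStable Φ N} (hlt : N' < N) (hpure : IsPure (subquotient Φ N' N hN' hN) lam)
    (hb : lam < b) : HasFiltrationBelow Φ N b := by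
  obtain ⟨r, F, l, st, hF0, hFr, hF, hFpure, hl, hlb⟩ := h
  have st' : ∀ i, IsStable Φ ((Fin.snoc F N : Fin (r + 1 + 1) → Submodule ConvLaurent M) i) := by
    intro i
    induction i using Fin.lastCases with
    | last => simpa using hN
    | cast i => simpa using st i
  refine ⟨r + 1, Fin.snoc F N, Fin.snoc l lam, st', ?_, by simp, ?_, fun i => ?_, ?_, fun i => ?_⟩
  · rw [← hF0]
    exact Fin.snoc_castSucc (α := fun _ => Submodule ConvLaurent M) N F 0
  · exact strictMono_snoc hF fun i => ((hF.monotone (Fin.le_last i)).trans hFr.le).trans_lt hlt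
  · induction i using Fin.lastCases with
    | last =>
      rw [Fin.snoc_last (α := fun _ => ℚ)]
      exact hpure.congr_subquotient ((Fin.snoc_castSucc _ _ _).trans hFr) (Fin.snoc_last _ _) _ _
    | cast i =>
      rw [Fin.snoc_castSucc (α := fun _ => ℚ)]
      refine (hFpure i).congr_subquotient (Fin.snoc_castSucc _ _ _) ?_ _ _
      rw [Fin.succ_castSucc]
      exact Fin.snoc_castSucc (α := fun _ => Submodule ConvLaurent M) N F i.succ
  · exact strictMono_snoc hl hlb
  · induction i using Fin.lastCases with
    | last => simpa using hb
    | cast i => simpa using (hlb i).trans hb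

theorem IsMinimalOperator.isStable_range {e : M} {L : ConvLaurent[X]}
    (he : IsMinimalOperator Φ e L) (hΦ : Function.Injective Φ) :
    IsStable Φ (LinearMap.range (operatorEval Φ e)) := by
  have hσ : Function.Surjective (qShift q : ConvLaurent →+* ConvLaurent) := (qShift q).surjective
  refine fun x => ⟨fun ⟨P, hP⟩ => ?_, fun ⟨P, hP⟩ => ?_⟩
  · obtain ⟨Q, -, hQ⟩ := exists_operatorEval_eq_of_operatorEval_eq_map hσ hΦ
      he.operatorEval_eq_zero (he.coeff_zero_ne_zero hσ hΦ) hP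
    exact ⟨Q, hQ⟩
  · exact ⟨shiftOperator _ P, by rw [operatorEval_shiftOperator, hP]⟩

theorem exists_slopesLT (L : ConvLaurent[X]) : ∃ b, SlopesLT L b := by
  have hev : ∀ᶠ b : ℚ in Filter.atTop, ∀ i ∈ L.support, 0 < i →
      (ord (L.coeff 0) : ℚ) < ord (L.coeff i) + b * i :=
    (Finset.eventually_all _).2 fun i _ => Filter.eventually_imp_distrib_left.2 fun hi =>
      (Filter.tendsto_atTop_add_const_left _ _
        (Filter.tendsto_id.atTop_mul_const (Nat.cast_pos.2 hi))).eventually_gt_atTop _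
  exact hev.exists

theorem hasFiltrationBelow_range (hq : ‖(q : ℂ)‖ ≤ 1) (hΦ : Function.Injective Φ) {e : M}
    {L : ConvLaurent[X]} (he : IsMinimalOperator Φ e L) (hb : SlopesLT L b) :
    HasFiltrationBelow Φ (LinearMap.range (operatorEval Φ e)) b := by
  induction hn : L.natDegree using Nat.strong_induction_on generalizing L e b with
  | _ n ih =>
  have h0 : L.coeff 0 ≠ 0 := he.coeff_zero_ne_zero (qShift q).surjective hΦ
  rcases Nat.eq_zero_or_pos L.natDegree with hL | hL
  · have he0 : e = 0 := by
      rw [← operatorEval_one (Φ := Φ) e,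
        ← Polynomial.eq_one_of_monic_natDegree_zero he.monic hL, he.operatorEval_eq_zero]
    have hrange : LinearMap.range (operatorEval Φ e) = ⊥ :=
      LinearMap.range_eq_bot.2 (LinearMap.ext fun P => by rw [he0, operatorEval_zero]; rfl)
    exact hrange ▸ hasFiltrationBelow_bot hΦ b
  obtain ⟨lam, A, B, rfl, hA, hB, hlam⟩ := exists_eq_skewMul_isPureOperator hq hL h0
  have hf := he.skewMul_right hB.monic
  have hstable := he.isStable_range hΦ
  have hmin (P : ConvLaurent[X]) (hP : P.degree < B.degree) :=
    he.eq_zero_of_operatorEval_mem_range hB.monic hP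
  have hdeg : A.natDegree < n := by
    rw [← hn, natDegree_skewMul hf.monic.ne_zero hB.monic.ne_zero]
    exact Nat.lt_add_of_pos_right hB.natDegree_pos
  have hlt : LinearMap.range (operatorEval Φ (operatorEval Φ e B)) <
      LinearMap.range (operatorEval Φ e) := by
    refine lt_of_le_of_ne (hstable.range_operatorEval_le ⟨B, rfl⟩) fun heq => ?_
    have hmem : operatorEval Φ e 1 ∈ LinearMap.range (operatorEval Φ (operatorEval Φ e B)) :=
      heq ▸ ⟨1, rfl⟩
    refine one_ne_zero (hmin 1 ?_ hmem)
    rw [Polynomial.degree_one]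
    exact Polynomial.natDegree_pos_iff_degree_pos.1 hB.natDegree_pos
  exact (ih A.natDegree hdeg hf hA rfl).snoc hlt
    (isPure_subquotient_range (h₁ := hf.isStable_range hΦ) (he := hstable) hB
      ⟨1, operatorEval_one _⟩ hmin) (hlam b hb)

/-- The monomial `c z ^ k` in `K`. -/
noncomputable def monomial (k : ℤ) (c : ℂ) : ConvLaurent :=
  ⟨HahnSeries.single k c, isConvergent_single k c⟩

theorem monomial_mul (k l : ℤ) (c d : ℂ) :
    monomial k c * monomial l d = monomial (k + l) (c * d) :=
  Subtype.ext HahnSeries.single_mul_single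

theorem monomial_injective (k : ℤ) : Function.Injective (monomial k) := fun _ _ h =>
  HahnSeries.single_injective k (congrArg Subtype.val h)

theorem monomial_zero_pow (c : ℂ) (n : ℕ) : monomial 0 c ^ n = monomial 0 (c ^ n) := by
  induction n with
  | zero => rfl
  | succ n ih => rw [pow_succ, ih, monomial_mul, pow_succ, add_zero]

theorem qShift_monomial (q : ℂˣ) (k : ℤ) (c : ℂ) :
    qShift q (monomial k c) = monomial k ((q : ℂ) ^ k * c) := by
  refine Subtype.ext (HahnSeries.ext (funext fun n => ?_))
  change (q : ℂ) ^ n * (HahnSeries.single k c).coeff n =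
    (HahnSeries.single k ((q : ℂ) ^ k * c)).coeff n
  rcases eq_or_ne n k with rfl | h
  · simp only [HahnSeries.coeff_single_same]
  · simp only [HahnSeries.coeff_single_of_ne h, mul_zero]

theorem qShift_monomial_zero (q : ℂˣ) (c : ℂ) : qShift q (monomial 0 c) = monomial 0 c := by
  rw [qShift_monomial, zpow_zero, one_mul]

variable [FiniteDimensional ConvLaurent M]

theorem exists_linearIndependent_iterate_finrank (hq : ¬ IsOfFinOrder q)
    (hΦ : Function.Surjective Φ) :
    ∃ e : M, LinearIndependent ConvLaurent
      fun i : Fin (Module.finrank ConvLaurent M) => Φ^[i] e := by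
  refine exists_linearIndependent_iterate Φ (u := monomial 0 q) (z := monomial 1 1)
    (Set.infinite_of_injective_forall_mem (monomial_injective 0) (qShift_monomial_zero q))
    (qShift_monomial_zero q q) (fun m n h => ?_) ?_ ?_ hΦ le_rfl
  · have hmn : monomial 0 ((q : ℂ) ^ m) = monomial 0 ((q : ℂ) ^ n) := by
      simpa only [monomial_zero_pow] using h
    exact injective_pow_iff_not_isOfFinOrder.2 hq
      (Units.ext (by simpa using monomial_injective 0 hmn))
  · refine (qShift_monomial q 1 1).trans ?_
    rw [monomial_mul, zpow_one, zero_add]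
  · have hne := (monomial_injective 1).ne (one_ne_zero (α := ℂ))
    rwa [show monomial 1 0 = 0 from Subtype.ext (map_zero _)] at hne

theorem exists_isSlopeFiltration (hq : ‖(q : ℂ)‖ ≤ 1) (hq' : ¬ IsOfFinOrder q)
    (hΦ : Function.Bijective Φ) :
    ∃ (r : ℕ) (N : Fin (r + 1) → Submodule ConvLaurent M) (lam : Fin r → ℚ),
      IsSlopeFiltration Φ N lam := by
  obtain ⟨e, hli⟩ := exists_linearIndependent_iterate_finrank hq' hΦ.surjective
  have hspan := hli.span_eq_top_of_card_eq_finrank' (Fintype.card_fin _)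
  obtain ⟨L, hL⟩ := exists_isMinimalOperator hli (hspan ▸ Submodule.mem_top)
  have htop : LinearMap.range (operatorEval Φ e) = ⊤ := by
    refine top_unique (hspan.ge.trans fun x hx => ?_)
    obtain ⟨P, -, hP⟩ := mem_span_iterate_iff.1 hx
    exact ⟨P, hP⟩
  obtain ⟨b, hb⟩ := exists_slopesLT L
  obtain ⟨r, F, lam, st, h0, hr, hF, hpure, hlam, -⟩ :=
    hasFiltrationBelow_range hq hΦ.injective hL hb
  exact ⟨r, F, lam, st, h0, hr.trans htop, hF, hpure, hlam⟩

end Existence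

section Uniqueness

theorem exists_forall_castSucc_lt_iff {α : Type*} [LinearOrder α] {r : ℕ} {f : Fin r → α}
    (hf : Monotone f) {x : α} (hx : x ∉ Set.range f) :
    ∃ j : Fin (r + 1), ∀ l : Fin r, l.castSucc < j ↔ f l < x := by
  obtain ⟨j, hj, hmin⟩ := WellFounded.has_min (wellFounded_lt (α := Fin (r + 1)))
    {j | ∀ l : Fin r, j ≤ l.castSucc → x < f l}
    ⟨Fin.last r, fun l hl => absurd hl (not_le.2 l.castSucc_lt_last)⟩
  refine ⟨j, fun l => ⟨fun hl => ?_, fun hl => not_le.1 fun hjl => hl.not_gt (hj l hjl)⟩⟩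
  by_contra! hxl
  have hlt : x < f l := hxl.lt_of_ne fun h => hx ⟨l, h.symm⟩
  exact hmin l.castSucc (fun k hk => hlt.trans_le (hf (Fin.castSucc_le_castSucc_iff.1 hk))) hl

variable {q : ℂˣ} {M : Type*} [AddCommGroup M] [Module ConvLaurent M]
  {Φ : M →ₛₗ[(qShift q : ConvLaurent →+* ConvLaurent)] M}
  {r r' : ℕ} {N : Fin (r + 1) → Submodule ConvLaurent M} {lam : Fin r → ℚ}
  {N' : Fin (r' + 1) → Submodule ConvLaurent M} {lam' : Fin r' → ℚ}

namespace IsSlopeFiltration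

theorem le_of_forall_slope_ne (h : IsSlopeFiltration Φ N lam) (h' : IsSlopeFiltration Φ N' lam')
    (i : Fin (r + 1)) (j : Fin (r' + 1))
    (hne : ∀ s : Fin r, s.castSucc < i → ∀ l : Fin r', j ≤ l.castSucc → lam s ≠ lam' l) :
    N i ≤ N' j := by
  induction i using Fin.induction generalizing j with
  | zero => exact h.bot.le.trans bot_le
  | succ i ihi =>
    induction j using Fin.reverseInduction with
    | last => exact le_top.trans h'.top.ge
    | cast j ihj =>
      exact (h.pure i).le_of_slope_ne (h'.pure j) (hne i Fin.castSucc_lt_succ j le_rfl)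
        (ihi _ fun s hs => hne s (hs.trans Fin.castSucc_lt_succ))
        (ihj fun s hs l hl => hne s hs l (Fin.castSucc_lt_succ.le.trans hl))

theorem range_subset (h : IsSlopeFiltration Φ N lam) (h' : IsSlopeFiltration Φ N' lam') :
    Set.range lam ⊆ Set.range lam' := by
  rintro _ ⟨s, rfl⟩
  by_contra hs
  obtain ⟨j, hj⟩ := exists_forall_castSucc_lt_iff h'.slopes_strictMono.monotone hs
  have hle : N s.succ ≤ N' j := h.le_of_forall_slope_ne h' _ _ fun t ht l hl heq =>
    hs ⟨l, (heq.ge.trans (h.slopes_strictMono.monotone (Fin.castSucc_lt_succ_iff.1 ht))).antisymm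
      (not_lt.1 ((hj l).not.1 hl.not_gt))⟩
  have hge : N' j ≤ N s.castSucc := h'.le_of_forall_slope_ne h _ _ fun l hl t ht =>
    (((hj l).1 hl).trans_le
      (h.slopes_strictMono.monotone (Fin.castSucc_le_castSucc_iff.1 ht))).ne
  exact (hle.trans hge).not_gt (h.strictMono Fin.castSucc_lt_succ)

theorem unique (h : IsSlopeFiltration Φ N lam) (h' : IsSlopeFiltration Φ N' lam') :
    ∃ e : r' = r, (∀ i : Fin (r' + 1), N' i = N (Fin.cast (congrArg (· + 1) e) i)) ∧
      ∀ i : Fin r', lam' i = lam (Fin.cast e i) := by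
  have hrange : Set.range lam' = Set.range lam :=
    (h'.range_subset h).antisymm (h.range_subset h')
  obtain rfl : r' = r := by
    have hcard := Nat.card_range_of_injective h'.slopes_strictMono.injective
    rw [hrange, Nat.card_range_of_injective h.slopes_strictMono.injective] at hcard
    simpa only [Nat.card_fin] using hcard.symm
  obtain rfl := (h'.slopes_strictMono.range_inj h.slopes_strictMono).1 hrange
  have hne (i : Fin (r' + 1)) (s : Fin r') (hs : s.castSucc < i) (l : Fin r')
      (hl : i ≤ l.castSucc) : lam' s ≠ lam' l :=
    (h.slopes_strictMono (Fin.castSucc_lt_castSucc_iff.1 (hs.trans_le hl))).ne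
  exact ⟨rfl, fun i => (h'.le_of_forall_slope_ne h i i (hne i)).antisymm
    (h.le_of_forall_slope_ne h' i i (hne i)), fun _ => rfl⟩

end IsSlopeFiltration

end Uniqueness

end QDiff

theorem theorem3p2_general (q : ℂˣ) (hq : ‖(q : ℂ)‖ ≤ 1) (hq' : ¬ IsOfFinOrder q)
    {M : Type*} [AddCommGroup M] [Module QDiff.ConvLaurent M]
    [FiniteDimensional QDiff.ConvLaurent M]
    (Φ : M →ₛₗ[(QDiff.qShift q : QDiff.ConvLaurent →+* QDiff.ConvLaurent)] M)
    (hΦ : Function.Bijective Φ) :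
    ∃ (r : ℕ) (N : Fin (r + 1) → Submodule QDiff.ConvLaurent M) (lam : Fin r → ℚ),
      QDiff.IsSlopeFiltration Φ N lam ∧
      ∀ (r' : ℕ) (N' : Fin (r' + 1) → Submodule QDiff.ConvLaurent M) (lam' : Fin r' → ℚ),
        QDiff.IsSlopeFiltration Φ N' lam' →
          ∃ h : r' = r, (∀ i : Fin (r' + 1), N' i = N (Fin.cast (congrArg (· + 1) h) i)) ∧
            ∀ i : Fin r', lam' i = lam (Fin.cast h i) := by
  obtain ⟨r, N, lam, h⟩ := QDiff.exists_isSlopeFiltration (Φ := Φ) hq hq' hΦ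
  exact ⟨r, N, lam, h, fun _ _ _ h' => h.unique h'⟩

theorem theorem3p2 (q : ℂˣ) (hq : ‖(q : ℂ)‖ < 1)
    {M : Type*} [AddCommGroup M] [Module QDiff.ConvLaurent M]
    [FiniteDimensional QDiff.ConvLaurent M]
    (Φ : M →ₛₗ[(QDiff.qShift q : QDiff.ConvLaurent →+* QDiff.ConvLaurent)] M)
    (hΦ : Function.Bijective Φ) :
    ∃ (r : ℕ) (N : Fin (r + 1) → Submodule QDiff.ConvLaurent M) (lam : Fin r → ℚ),
      QDiff.IsSlopeFiltration Φ N lam ∧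
      ∀ (r' : ℕ) (N' : Fin (r' + 1) → Submodule QDiff.ConvLaurent M) (lam' : Fin r' → ℚ),
        QDiff.IsSlopeFiltration Φ N' lam' →
          ∃ h : r' = r, (∀ i : Fin (r' + 1), N' i = N (Fin.cast (congrArg (· + 1) h) i)) ∧
            ∀ i : Fin r', lam' i = lam (Fin.cast h i) :=
  theorem3p2_general q hq.le
    (fun h => hq.ne (Units.isOfFinOrder_val.2 h).norm_eq_one) Φ hΦ
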